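/- **Notation.** A function $g:(0,\infty)\to\mathbb R$ is completely monotonic if it is infinitely often differentiable and $(-1)^n g^{(n)}(x)\ge 0$ for all $n\ge 0$, $x>0$. Let $\mathcal A_0$ be the set of positive Borel measures $\sigma$ on $[0,\infty)$ with $\int_0^\infty e^{-xs}\,d\sigma(s)<\infty$ for all $x>0$. For $\sigma\in\mathcal A_0$ write $\xi\in\mathcal A_1(\sigma)$ if $\xi(t)=\sigma([0,t])$ for all $t\ge 0$; for $n\ge 2$ write $\xi\in\mathcal A_n(\sigma)$ if $\xi:[0,\infty)\to\mathbb R$ is $n-2$ times differentiable, $\xi^{(j)}(0)=0$ for $0\le j\le n-2$, and $\xi^{(n-2)}(t)=\int_0^t\sigma([0,s])\,ds$ for all $t\ge0$. **Theorem.** Let $f:(0,\infty)\to\mathbb R$ and let $k\ge 1$ be an integer. Suppose that $(-1)^j(x^jf(x))^{(j)}$ is completely monotonic for $j=0,\dots,k$. Then there are a function $p:[0,\infty)\to\mathbb R$ and measures $\sigma,\sigma_0,\dots,\sigma_{k-1}\in\mathcal A_0$ such that $$f(x)=\int_0^\infty e^{-xt}p(t)\,dt,\qquad x>0,$$ with the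 integral absolutely convergent, and such that: - $t^{k-1}p(t)\in\mathcal A_k(\sigma)$; - if $k\ge 2$, then $p$ is $k-2$ times continuously differentiable on $[0,\infty)$ (one-sided derivatives at $0$) and $p^{(k-2)}$ has a right-hand derivative at every $t\ge 0$, denoted by $p^{(k-1)}(t)$; - $t^jp^{(j)}(t)\in\mathcal A_1(\sigma_j)$ for $0\le j\le k-1$; - the measure $d\sigma_k(t)=t\,d\sigma_{k-1}(t)-(k-1)\,\sigma_{k-1}([0,t])\,dt$ on $[0,\infty)$ is positive and belongs to $\mathcal A_0$. Furthermore, for all $x>0$, $$(-1)^j(x^jf(x))^{(j)}=\int_0^\infty e^{-xt}\,t^jp^{(j)}(t)\,dt\quad(0\le j\le k-1),\qquad (-1)^k(x^kf(x))^{(k)}=\int_0^\infty e^{-xt}\,d\sigma_k(t),$$ all the integrals being absolutely convergent. -/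

import Mathlib

open MeasureTheory Set
open scoped ContDiff

namespace LaplaceCM

/-- `g`, regarded as a function on `(0, ∞)`, is completely monotonic: it is smooth and
`(-1)^n g^{(n)} ≥ 0` on `(0, ∞)` for all `n ≥ 0`. -/
def CompletelyMonotonic (g : ℝ → ℝ) : Prop :=
  ContDiffOn ℝ ∞ g (Ioi 0) ∧
    ∀ n : ℕ, ∀ x : ℝ, 0 < x → 0 ≤ (-1 : ℝ) ^ n * iteratedDerivWithin n g (Ioi 0) x

/-- The function `x ↦ (-1)^j (x^j f(x))^{(j)}` on `(0, ∞)`. -/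
noncomputable def widder (f : ℝ → ℝ) (j : ℕ) : ℝ → ℝ :=
  fun x => (-1 : ℝ) ^ j * iteratedDerivWithin j (fun y => y ^ j * f y) (Ioi 0) x

/-- The set `A_0` of positive Borel measures on `[0, ∞)` with `∫ e^{-xs} dσ(s) < ∞` for all
`x > 0`. A measure on `[0, ∞)` is a measure on `ℝ` for which `(-∞, 0)` is a null set. -/
def MemA0 (σ : Measure ℝ) : Prop :=
  σ (Iio 0) = 0 ∧ ∀ x : ℝ, 0 < x → Integrable (fun s => Real.exp (-(x * s))) σ

/-- The function `t ↦ σ([0, t])`. -/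
noncomputable def distFun (σ : Measure ℝ) (t : ℝ) : ℝ := σ.real (Icc 0 t)

/-- `MemA n σ ξ`: `σ ∈ A_0` and the function `ξ` on `[0, ∞)` belongs to `A_n(σ)`, for `n ≥ 1`
(there is no such class of functions for `n = 0`). For `n = m + 2`, the functions
`X 0, …, X m` are the derivatives of `ξ` on `[0, ∞)` of orders `0, …, m`, one-sided at `0`. -/
def MemA : ℕ → Measure ℝ → (ℝ → ℝ) → Prop
  | 0, _, _ => False
  | 1, σ, ξ => MemA0 σ ∧ ∀ t : ℝ, 0 ≤ t → ξ t = distFun σ t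
  | m + 2, σ, ξ => MemA0 σ ∧ ∃ X : ℕ → ℝ → ℝ,
      (∀ t : ℝ, 0 ≤ t → X 0 t = ξ t) ∧
      (∀ j : ℕ, j < m → ∀ t : ℝ, 0 ≤ t → HasDerivWithinAt (X j) (X (j + 1) t) (Ici 0) t) ∧
      (∀ j : ℕ, j ≤ m → X j 0 = 0) ∧
      ∀ t : ℝ, 0 ≤ t → X m t = ∫ s in (0 : ℝ)..t, distFun σ s

/-- `P 0, …, P (k - 1)` are the derivatives `p, p', …, p^{(k-1)}` of `p` on `[0, ∞)`.
Those of order at most `k - 2` are continuous ordinary derivatives (one-sided at `0`), and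
`p^{(k-1)}` is, for `k ≥ 2`, the right-hand derivative of `p^{(k-2)}` at every point of `[0, ∞)`. -/
def IsDerivSeq (k : ℕ) (p : ℝ → ℝ) (P : ℕ → ℝ → ℝ) : Prop :=
  (∀ t : ℝ, 0 ≤ t → P 0 t = p t) ∧
  (∀ j : ℕ, j + 2 < k → ∀ t : ℝ, 0 ≤ t → HasDerivWithinAt (P j) (P (j + 1) t) (Ici 0) t) ∧
  (∀ j : ℕ, j + 2 = k → ContinuousOn (P j) (Ici 0) ∧
    ∀ t : ℝ, 0 ≤ t → HasDerivWithinAt (P j) (P (j + 1) t) (Ici t) t)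

/-- `dν(t) = t dμ(t) - c μ([0, t]) dt` on `[0, ∞)`, for positive measures `μ` and `ν`, written
without subtraction. For `μ ∈ A_0` all three measures are finite on bounded sets, so `ν` is
determined by `μ`, and such a `ν` exists exactly if `t dμ(t) - c μ([0, t]) dt` is positive. -/
def IsDiffMeasure (c : ℝ) (μ ν : Measure ℝ) : Prop :=
  ν + (volume.restrict (Ici 0)).withDensity (fun t => ENNReal.ofReal (c * distFun μ t)) =
    μ.withDensity (fun t => ENNReal.ofReal t)

end LaplaceCM

namespace LaplaceCM

open Filter Topology Polynomial

/-! ### The Hausdorff moment problem -/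

/-! Write $w_j=(-1)^j(x^jf)^{(j)}$. The proof rests on the identity $(x\,w_j)'=-(w_{j+1}+j\,w_j)$
(`hasDerivAt_id_mul_widder`). Its right side is minus a completely monotonic function when $j<k$,
and $x\,w_j\ge 0$, so $x\,w_j$ is itself completely monotonic. By Bernstein's theorem
(`IsCM.exists_isLaplace`) it is the Laplace transform of a measure $\sigma_j$, and dividing by $x$
shows that $w_j$ is the transform of the function $G_j(t)=\sigma_j([0,t])$. For $j=k$ Bernstein's
theorem is applied to $w_k$ itself and gives $\sigma_k$.

Read through uniqueness of Laplace transforms, the same identity says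
$t\,d\sigma_j=d\kappa+j\,G_j\,dt$, where $\kappa$ represents $w_{j+1}$ (`mulId_eq_add`). At $j=k-1$
this is the asserted formula for $\sigma_k$. Integrating by parts over $[0,t]$ gives
$t\,G_j(t)=\kappa([0,t])+(j+1)\int_0^tG_j$ (`mul_distFun_eq`). For $j<k-1$ the measure $\kappa$ has
density $G_{j+1}$, and the quotient rule turns this into $(G_j/t^j)'=G_{j+1}/t^{j+1}$ as a right
derivative. Hence $p=G_0$ satisfies $t^jp^{(j)}=G_j$ away from $0$. Each $G_j/t^j$ is nonnegative
and increasing (`monotoneOn_div_pow`), so it has a finite limit at $0$, which extends everything to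
$[0,\infty)$.

Finally, the $(k-1)$-st derivative of $t^{k-1}p$ is a combination of the $t^lp^{(l)}=G_l$ with
nonnegative coefficients, hence the distribution function of the same combination of the $\sigma_l$
(`memA_of_isDerivSeq`).

Bernstein's theorem is derived from Hausdorff's moment theorem, applied to the samples of $g$ on
arithmetic progressions. -/

/-- The backward difference `a n - a (n + 1)` of a sequence. -/
def bdiff (a : ℕ → ℝ) : ℕ → ℝ := fun n => a n - a (n + 1)

/-- The linear functional on polynomials with `X ^ n ↦ a n`. -/
noncomputable def momentFunctional (a : ℕ → ℝ) : ℝ[X] →ₗ[ℝ] ℝ :=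
  Polynomial.lsum fun n => a n • LinearMap.id

lemma momentFunctional_monomial (a : ℕ → ℝ) (n : ℕ) (c : ℝ) :
    momentFunctional a (monomial n c) = a n * c := by
  simp [momentFunctional, Polynomial.lsum_apply, Polynomial.sum_monomial_index]

lemma momentFunctional_X_pow (a : ℕ → ℝ) (n : ℕ) : momentFunctional a (X ^ n) = a n := by
  rw [← monomial_one_right_eq_X_pow, momentFunctional_monomial, mul_one]

lemma momentFunctional_mul_one_sub (a : ℕ → ℝ) (p : ℝ[X]) :
    momentFunctional a (p * (1 - X)) = momentFunctional (bdiff a) p := by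
  induction p using Polynomial.induction_on' with
  | add p q hp hq => rw [add_mul, map_add, map_add, hp, hq]
  | monomial n c =>
    rw [mul_sub, mul_one, monomial_mul_X, map_sub, momentFunctional_monomial,
      momentFunctional_monomial, momentFunctional_monomial, bdiff]
    ring

lemma momentFunctional_X_pow_mul (a : ℕ → ℝ) (n m : ℕ) :
    momentFunctional a (X ^ n * (1 - X) ^ m) = bdiff^[m] a n := by
  induction m generalizing a with
  | zero => simp [momentFunctional_X_pow]
  | succ m ih =>
    rw [pow_succ, ← mul_assoc, momentFunctional_mul_one_sub, ih, Function.iterate_succ_apply]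

lemma momentFunctional_bernstein (a : ℕ → ℝ) (n ν : ℕ) :
    momentFunctional a (bernsteinPolynomial ℝ n ν) = n.choose ν * bdiff^[n - ν] a ν := by
  rw [bernsteinPolynomial, mul_assoc, ← momentFunctional_X_pow_mul, ← nsmul_eq_mul, map_nsmul,
    nsmul_eq_mul]

/-- The identity $\binom{n}{m+i}\binom{m+i}{m}=\binom nm\binom{n-m}{i}$ pulls out $X^m$ and leaves
the partition of unity in degree $d$. It makes the factorial moments of the discrete measures below
exact. -/
lemma sum_choose_mul_bernstein (m d : ℕ) :
    ∑ ν ∈ Finset.range (m + d + 1), (ν.choose m : ℝ) • bernsteinPolynomial ℝ (m + d) ν =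
      ((m + d).choose m : ℝ) • (X : ℝ[X]) ^ m := by
  rw [add_assoc, Finset.sum_range_add, Finset.sum_eq_zero, zero_add]
  · have key : ∀ i, ((m + i).choose m : ℝ) • bernsteinPolynomial ℝ (m + d) (m + i) =
        (((m + d).choose m : ℝ) • (X : ℝ[X]) ^ m) * bernsteinPolynomial ℝ d i := by
      intro i
      have h := Nat.choose_mul (n := m + d) (k := m + i) (s := m) (Nat.le_add_right _ _)
      simp only [Nat.add_sub_cancel_left] at h
      have h' : ((m + d).choose (m + i) : ℝ[X]) * ((m + i).choose m : ℝ[X]) =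
          ((m + d).choose m : ℝ[X]) * (d.choose i : ℝ[X]) := by exact_mod_cast h
      simp only [bernsteinPolynomial, Nat.add_sub_add_left, smul_eq_C_mul, map_natCast, pow_add]
      linear_combination (X ^ m * X ^ i * (1 - X) ^ (d - i)) * h'
    simp_rw [key, ← Finset.mul_sum, bernsteinPolynomial.sum, mul_one]
  · intro i hi
    rw [Nat.choose_eq_zero_of_lt (Finset.mem_range.mp hi)]
    simp

/-- The two products are compared factor by factor: $(\nu-m)/(n-m)$ differs from $\nu/n$ by at most
$m/n$, also when the natural subtraction truncates, since then $\nu\le m$. -/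
lemma abs_descFactorial_div_sub_pow_le {n ν : ℕ} (hν : ν ≤ n) (m : ℕ) (hm : m ≤ n) :
    |(ν.descFactorial m : ℝ) / n.descFactorial m - ((ν : ℝ) / n) ^ m| ≤ (m : ℝ) * m / n := by
  induction m with
  | zero => simp
  | succ m ih =>
    have ih := ih (by omega)
    have hn : (0 : ℝ) < n := by exact_mod_cast (by omega : 0 < n)
    have hνn : (ν : ℝ) ≤ n := by exact_mod_cast hν
    have hmn : (m : ℝ) < n := by exact_mod_cast hm
    have hnm : (0 : ℝ) < n - m := by linarith
    set R : ℝ := (ν.descFactorial m : ℝ) / n.descFactorial m with hR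
    set q : ℝ := (ν : ℝ) / n with hq
    have hq0 : 0 ≤ q := by positivity
    have hq1 : q ≤ 1 := (div_le_one hn).2 hνn
    have hR0 : 0 ≤ R := by positivity
    have hR1 : R ≤ 1 := by
      have h1 : (ν.descFactorial m : ℝ) ≤ n.descFactorial m := by
        exact_mod_cast Nat.descFactorial_le m hν
      exact div_le_one_of_le₀ h1 (by positivity)
    set s : ℝ := ((ν - m : ℕ) : ℝ) / ((n - m : ℕ) : ℝ) with hs
    have hsucc : (ν.descFactorial (m + 1) : ℝ) / n.descFactorial (m + 1) = s * R := by
      rw [Nat.descFactorial_succ, Nat.descFactorial_succ]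
      push_cast
      rw [hs, hR, mul_div_mul_comm]
    have hsq : |s - q| ≤ m / n := by
      have hnm' : ((n - m : ℕ) : ℝ) = n - m := by rw [Nat.cast_sub (by omega)]
      rcases le_total m ν with h | h
      · have hνm' : ((ν - m : ℕ) : ℝ) = ν - m := by rw [Nat.cast_sub h]
        have hmν : (m : ℝ) ≤ ν := by exact_mod_cast h
        have : q - s = (m / n) * ((n - ν) / (n - m)) := by
          rw [hs, hq, hnm', hνm']
          field_simp
          ring
        rw [abs_sub_comm, this, abs_of_nonneg
          (mul_nonneg (by positivity) (div_nonneg (by linarith) hnm.le))]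
        refine mul_le_of_le_one_right (by positivity) ((div_le_one hnm).2 (by linarith))
      · have : s = 0 := by rw [hs, Nat.sub_eq_zero_of_le h]; simp
        have hνm : (ν : ℝ) ≤ m := by exact_mod_cast h
        rw [this, zero_sub, abs_neg, abs_of_nonneg hq0]
        exact div_le_div_of_nonneg_right hνm hn.le
    calc |(ν.descFactorial (m + 1) : ℝ) / n.descFactorial (m + 1) - q ^ (m + 1)|
        = |(s - q) * R + q * (R - q ^ m)| := by rw [hsucc]; congr 1; ring
      _ ≤ |s - q| * R + q * |R - q ^ m| := by
        refine (abs_add_le _ _).trans (le_of_eq ?_)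
        rw [abs_mul, abs_mul, abs_of_nonneg hR0, abs_of_nonneg hq0]
      _ ≤ m / n * 1 + 1 * (m * m / n) := by gcongr
      _ ≤ ((m + 1 : ℕ) : ℝ) * (m + 1 : ℕ) / n := by
        push_cast
        rw [mul_one, one_mul, ← add_div]
        gcongr
        nlinarith [(Nat.cast_nonneg m : (0 : ℝ) ≤ m)]

/-- The factorial moments of these nonnegative weights equal `a m` exactly once $m\le n$. Replacing
falling factorials by powers costs at most $m^2/n$ times the total mass `a 0`. -/
lemma tendsto_bernstein_moment (a : ℕ → ℝ) (ha : ∀ m n, 0 ≤ bdiff^[m] a n) (m : ℕ) :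
    Tendsto (fun n : ℕ => ∑ ν ∈ Finset.range (n + 1),
      (n.choose ν * bdiff^[n - ν] a ν) * ((ν : ℝ) / n) ^ m) atTop (𝓝 (a m)) := by
  have hb : ∀ n ν : ℕ, 0 ≤ n.choose ν * bdiff^[n - ν] a ν := fun n ν =>
    mul_nonneg (Nat.cast_nonneg _) (ha _ _)
  have hmass : ∀ n : ℕ, ∑ ν ∈ Finset.range (n + 1), (n.choose ν * bdiff^[n - ν] a ν) = a 0 := by
    intro n
    simp_rw [← momentFunctional_bernstein, ← map_sum, bernsteinPolynomial.sum]
    simpa using momentFunctional_X_pow a 0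
  have hfact : ∀ n : ℕ, m ≤ n → ∑ ν ∈ Finset.range (n + 1), (n.choose ν * bdiff^[n - ν] a ν) *
      ((ν.descFactorial m : ℝ) / n.descFactorial m) = a m := by
    intro n hn
    obtain ⟨d, rfl⟩ := Nat.exists_eq_add_of_le hn
    have h := congrArg (momentFunctional a) (sum_choose_mul_bernstein m d)
    simp only [map_sum, map_smul, momentFunctional_bernstein, momentFunctional_X_pow,
      smul_eq_mul] at h
    have hpos : (0 : ℝ) < ((m + d).choose m : ℝ) := by
      exact_mod_cast Nat.choose_pos (Nat.le_add_right _ _)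
    have hm : (m.factorial : ℝ) ≠ 0 := by exact_mod_cast m.factorial_ne_zero
    rw [← mul_right_inj' hpos.ne', ← h, Finset.mul_sum]
    refine Finset.sum_congr rfl fun ν _ => ?_
    rw [Nat.descFactorial_eq_factorial_mul_choose, Nat.descFactorial_eq_factorial_mul_choose]
    push_cast
    field_simp
  rw [tendsto_iff_norm_sub_tendsto_zero]
  refine squeeze_zero' (g := fun n : ℕ => a 0 * ((m : ℝ) * m) / n)
    (Eventually.of_forall fun _ => norm_nonneg _) ?_ (tendsto_const_div_atTop_nhds_zero_nat _)
  filter_upwards [eventually_ge_atTop m] with n hn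
  rw [Real.norm_eq_abs, ← hfact n hn, ← Finset.sum_sub_distrib]
  refine (Finset.abs_sum_le_sum_abs _ _).trans ?_
  calc _ ≤ ∑ ν ∈ Finset.range (n + 1), (n.choose ν * bdiff^[n - ν] a ν) * ((m : ℝ) * m / n) := by
        refine Finset.sum_le_sum fun ν hν => ?_
        rw [← mul_sub, abs_mul, abs_of_nonneg (hb n ν), abs_sub_comm]
        exact mul_le_mul_of_nonneg_left (abs_descFactorial_div_sub_pow_le
          (by simpa [Nat.lt_succ_iff] using hν) m hn) (hb n ν)
    _ = a 0 * ((m : ℝ) * m) / n := by rw [← Finset.sum_mul, hmass]; ring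

/-- **Hausdorff's theorem**: a completely monotonic sequence is the moment sequence of a finite
measure on `[0, 1]`. -/
theorem exists_measure_moments (a : ℕ → ℝ) (ha : ∀ m n, 0 ≤ bdiff^[m] a n) :
    ∃ μ : Measure ℝ, IsFiniteMeasure μ ∧ (∀ᵐ y ∂μ, y ∈ Icc (0 : ℝ) 1) ∧
      ∀ m : ℕ, ∫ y, y ^ m ∂μ = a m := by
  have hb : ∀ n ν : ℕ, 0 ≤ n.choose ν * bdiff^[n - ν] a ν := fun n ν =>
    mul_nonneg (Nat.cast_nonneg _) (ha _ _)
  have hpt : ∀ n ν : ℕ, ν ∈ Finset.range (n + 1) → (ν : ℝ) / n ∈ Icc (0 : ℝ) 1 := fun n ν hν =>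
    ⟨by positivity, div_le_one_of_le₀ (by exact_mod_cast Nat.lt_succ_iff.1 (Finset.mem_range.1 hν))
      (by positivity)⟩
  let pt : ℕ → ℕ → Icc (0 : ℝ) 1 := fun n ν => projIcc 0 1 zero_le_one ((ν : ℝ) / n)
  let D : ℕ → Measure (Icc (0 : ℝ) 1) := fun n => ∑ ν ∈ Finset.range (n + 1),
    ENNReal.ofReal (n.choose ν * bdiff^[n - ν] a ν) • Measure.dirac (pt n ν)
  have hfinsmul : ∀ n ν, IsFiniteMeasure (ENNReal.ofReal (n.choose ν * bdiff^[n - ν] a ν) •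
      Measure.dirac (pt n ν)) := fun n ν => Measure.smul_finite _ ENNReal.ofReal_ne_top
  have hfin : ∀ n, IsFiniteMeasure (D n) := fun n => by
    dsimp only [D]
    infer_instance
  have hint : ∀ (n : ℕ) (φ : BoundedContinuousFunction (Icc (0 : ℝ) 1) ℝ), ∫ y, φ y ∂(D n) =
      ∑ ν ∈ Finset.range (n + 1), (n.choose ν * bdiff^[n - ν] a ν) * φ (pt n ν) := by
    intro n φ
    rw [integral_finsetSum_measure fun ν _ => φ.integrable _]
    refine Finset.sum_congr rfl fun ν _ => ?_
    rw [integral_smul_measure, integral_dirac, ENNReal.toReal_ofReal (hb n ν), smul_eq_mul]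
  let DF : ℕ → FiniteMeasure (Icc (0 : ℝ) 1) := fun n => ⟨D n, hfin n⟩
  let pw : ℕ → BoundedContinuousFunction (Icc (0 : ℝ) 1) ℝ := fun m =>
    BoundedContinuousFunction.mkOfCompact ⟨fun y => (y : ℝ) ^ m, by fun_prop⟩
  have hmom : ∀ m, Tendsto (fun n => ∫ y, pw m y ∂(D n)) atTop (𝓝 (a m)) := by
    intro m
    refine (tendsto_bernstein_moment a ha m).congr fun n => ?_
    rw [hint]
    refine Finset.sum_congr rfl fun ν hν => ?_
    simp only [pw, pt, BoundedContinuousFunction.mkOfCompact_apply, ContinuousMap.coe_mk]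
    rw [projIcc_of_mem zero_le_one (hpt n ν hν)]
  have hmass : ∀ n, (DF n).mass ≤ (a 0).toNNReal := by
    intro n
    have h1 : ∫ y, (pw 0) y ∂(D n) = a 0 := by
      rw [hint]
      simp only [pw, BoundedContinuousFunction.mkOfCompact_apply, ContinuousMap.coe_mk, pow_zero,
        mul_one]
      simp_rw [← momentFunctional_bernstein, ← map_sum, bernsteinPolynomial.sum]
      simpa using momentFunctional_X_pow a 0
    have h2 : ((DF n).mass : ℝ) = a 0 := by
      rw [← h1]
      simp [pw, DF, FiniteMeasure.mass, measureReal_def]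
      rfl
    exact NNReal.le_toNNReal_of_coe_le h2.le
  -- The measures of mass at most `a 0` on a compact space form a weakly compact set. A limit along
  -- an ultrafilter replaces the extraction of a subsequence.
  obtain ⟨μ, -, hμ⟩ := (isCompact_setOfPred_finiteMeasure_le_of_compactSpace (Icc (0 : ℝ) 1)
    (a 0).toNNReal).ultrafilter_le_nhds ((hyperfilter ℕ).map DF) (by
      rw [le_principal_iff]
      exact Filter.mem_map.2 (Filter.Eventually.of_forall hmass))
  have hμ' : Tendsto DF (hyperfilter ℕ) (𝓝 μ) := hμ
  rw [FiniteMeasure.tendsto_iff_forall_integral_tendsto] at hμ'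
  refine ⟨(μ : Measure (Icc (0 : ℝ) 1)).map Subtype.val, inferInstance, ?_, fun m => ?_⟩
  · exact (ae_map_iff measurable_subtype_coe.aemeasurable measurableSet_Icc).2
      (ae_of_all _ fun y => y.2)
  · rw [integral_map measurable_subtype_coe.aemeasurable (by fun_prop)]
    exact tendsto_nhds_unique (hμ' (pw m))
      ((hmom m).mono_left (Nat.hyperfilter_le_atTop))

lemma integrable_of_continuous_of_ae_mem_Icc {μ : Measure ℝ} [IsFiniteMeasure μ]
    (h : ∀ᵐ y ∂μ, y ∈ Icc (0 : ℝ) 1) {φ : ℝ → ℝ} (hφ : Continuous φ) : Integrable φ μ := by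
  rw [← Measure.restrict_eq_self_of_ae_mem h]
  exact hφ.continuousOn.integrableOn_compact isCompact_Icc

/-- A finite measure on `[0, 1]` is determined by its moments. -/
theorem ext_of_moments {μ ν : Measure ℝ} [IsFiniteMeasure μ] [IsFiniteMeasure ν]
    (hμ : ∀ᵐ y ∂μ, y ∈ Icc (0 : ℝ) 1) (hν : ∀ᵐ y ∂ν, y ∈ Icc (0 : ℝ) 1)
    (h : ∀ m : ℕ, ∫ y, y ^ m ∂μ = ∫ y, y ^ m ∂ν) : μ = ν := by
  have hpoly : ∀ p : ℝ[X], ∫ y, p.eval y ∂μ = ∫ y, p.eval y ∂ν := by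
    intro p
    induction p using Polynomial.induction_on' with
    | add p q hp hq =>
      simp only [eval_add]
      rw [integral_add, integral_add, hp, hq]
      all_goals
        first
        | exact integrable_of_continuous_of_ae_mem_Icc hμ (Polynomial.continuous _)
        | exact integrable_of_continuous_of_ae_mem_Icc hν (Polynomial.continuous _)
    | monomial n c => simp only [eval_monomial, integral_const_mul, h]
  refine ext_of_forall_integral_eq_of_IsFiniteMeasure fun φ => ?_
  have hclose : ∀ {κ : Measure ℝ} [IsFiniteMeasure κ], (∀ᵐ y ∂κ, y ∈ Icc (0 : ℝ) 1) → ∀ {ε : ℝ}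
      {p : ℝ[X]}, (∀ x ∈ Icc (0 : ℝ) 1, |p.eval x - φ x| < ε) →
      |∫ y, p.eval y ∂κ - ∫ y, φ y ∂κ| ≤ ε * κ.real univ := by
    intro κ _ hκ ε p hp
    rw [← integral_sub (integrable_of_continuous_of_ae_mem_Icc hκ p.continuous) (φ.integrable _),
      ← Real.norm_eq_abs]
    exact norm_integral_le_of_norm_le_const (hκ.mono fun y hy => (hp y hy).le)
  refine eq_of_forall_dist_le fun ε hε => ?_
  have hM : 0 < μ.real univ + ν.real univ + 1 := by positivity
  -- Weierstrass approximation. The added 1 keeps the denominator positive when both measures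
  -- vanish.
  obtain ⟨p, hp⟩ := exists_polynomial_near_of_continuousOn 0 1 φ φ.continuous.continuousOn
    (ε / (μ.real univ + ν.real univ + 1)) (by positivity)
  have h1 := hclose hμ hp
  have h2 := hclose hν hp
  rw [hpoly p] at h1
  rw [Real.dist_eq]
  set I := ∫ y, p.eval y ∂ν
  have h3 : ε / (μ.real univ + ν.real univ + 1) * μ.real univ +
      ε / (μ.real univ + ν.real univ + 1) * ν.real univ ≤ ε := by
    rw [← mul_add, div_mul_eq_mul_div, div_le_iff₀ hM]
    nlinarith
  calc |∫ y, φ y ∂μ - ∫ y, φ y ∂ν| = |-(I - ∫ y, φ y ∂μ) + (I - ∫ y, φ y ∂ν)| := by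
        congr 1; ring
    _ ≤ |I - ∫ y, φ y ∂μ| + |I - ∫ y, φ y ∂ν| := by
        refine (abs_add_le _ _).trans_eq ?_
        rw [abs_neg]
    _ ≤ ε := by linarith

lemma lintegral_pow_eq {μ : Measure ℝ} [IsFiniteMeasure μ] (h : ∀ᵐ y ∂μ, y ∈ Icc (0 : ℝ) 1)
    (m : ℕ) : ∫⁻ y, ENNReal.ofReal (y ^ m) ∂μ = ENNReal.ofReal (∫ y, y ^ m ∂μ) :=
  (ofReal_integral_eq_lintegral_ofReal
    (integrable_of_continuous_of_ae_mem_Icc h (by fun_prop))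
    (h.mono fun _ hy => pow_nonneg hy.1 _)).symm

lemma ext_of_lintegral_pow {μ ν : Measure ℝ} [IsFiniteMeasure μ] [IsFiniteMeasure ν]
    (hμ : ∀ᵐ y ∂μ, y ∈ Icc (0 : ℝ) 1) (hν : ∀ᵐ y ∂ν, y ∈ Icc (0 : ℝ) 1)
    (h : ∀ m : ℕ, ∫⁻ y, ENNReal.ofReal (y ^ m) ∂μ = ∫⁻ y, ENNReal.ofReal (y ^ m) ∂ν) :
    μ = ν := by
  refine ext_of_moments hμ hν fun m => ?_
  have h1 := h m
  rw [lintegral_pow_eq hμ, lintegral_pow_eq hν] at h1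
  exact (ENNReal.ofReal_eq_ofReal_iff
    (integral_nonneg_of_ae (hμ.mono fun _ hy => pow_nonneg hy.1 _))
    (integral_nonneg_of_ae (hν.mono fun _ hy => pow_nonneg hy.1 _))).1 h1

/-! ### Laplace transforms -/

/-- `σ` is a measure on `[0, ∞)` with Laplace transform `g` on `(0, ∞)`. -/
def IsLaplace (σ : Measure ℝ) (g : ℝ → ℝ) : Prop :=
  σ (Iio 0) = 0 ∧ ∀ x : ℝ, 0 < x →
    0 ≤ g x ∧ ∫⁻ s, ENNReal.ofReal (Real.exp (-(x * s))) ∂σ = ENNReal.ofReal (g x)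

lemma ae_nonneg_of_null {σ : Measure ℝ} (h : σ (Iio 0) = 0) : ∀ᵐ s ∂σ, 0 ≤ s := by
  rw [ae_iff]
  simpa [Iio_def] using h

/-- The image under `s ↦ exp (-s)` of the measure `exp (-s) dσ(s)`. -/
noncomputable def expPush (σ : Measure ℝ) : Measure ℝ :=
  (σ.withDensity fun s => ENNReal.ofReal (Real.exp (-s))).map fun s => Real.exp (-s)

lemma measurable_exp_neg : Measurable fun s : ℝ => Real.exp (-s) := by fun_prop

lemma expPush_eq_self (σ : Measure ℝ) :
    ((expPush σ).map fun y => -Real.log y).withDensity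
      (fun s => ENNReal.ofReal (Real.exp s)) = σ := by
  have h1 : (fun y => -Real.log y) ∘ (fun s : ℝ => Real.exp (-s)) = id := by
    ext s; simp
  rw [expPush, Measure.map_map (by fun_prop) measurable_exp_neg, h1, Measure.map_id,
    ← withDensity_mul _ (by fun_prop) (by fun_prop)]
  convert withDensity_one using 2
  ext s
  simp [← ENNReal.ofReal_mul (Real.exp_pos _).le, ← Real.exp_add]

/-- The weight $e^{-s}$ makes the image measure finite and shifts the exponent: its moments are the
values of the Laplace transform at $1,2,3,\dots$. These values alone therefore determine the
measure. -/
lemma lintegral_expPush (σ : Measure ℝ) (m : ℕ) :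
    ∫⁻ y, ENNReal.ofReal (y ^ m) ∂(expPush σ) =
      ∫⁻ s, ENNReal.ofReal (Real.exp (-(((m : ℝ) + 1) * s))) ∂σ := by
  rw [expPush, lintegral_map (by fun_prop) measurable_exp_neg,
    lintegral_withDensity_eq_lintegral_mul _ (by fun_prop) (by fun_prop)]
  refine lintegral_congr fun s => ?_
  rw [Pi.mul_apply, ← ENNReal.ofReal_mul (Real.exp_pos _).le, ← Real.exp_nat_mul,
    ← Real.exp_add]
  congr 2
  ring

lemma IsLaplace.isFiniteMeasure_expPush {σ : Measure ℝ} {g : ℝ → ℝ} (h : IsLaplace σ g) :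
    IsFiniteMeasure (expPush σ) := by
  constructor
  have h1 := lintegral_expPush σ 0
  simp only [pow_zero, ENNReal.ofReal_one, lintegral_one, Nat.cast_zero, zero_add] at h1
  rw [h1, (h.2 1 one_pos).2]
  exact ENNReal.ofReal_lt_top

lemma IsLaplace.ae_expPush {σ : Measure ℝ} {g : ℝ → ℝ} (h : IsLaplace σ g) :
    ∀ᵐ y ∂(expPush σ), y ∈ Icc (0 : ℝ) 1 := by
  refine (ae_map_iff measurable_exp_neg.aemeasurable measurableSet_Icc).2 ?_
  refine (withDensity_absolutelyContinuous _ _).ae_le ?_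
  filter_upwards [ae_nonneg_of_null h.1] with s hs
  exact ⟨(Real.exp_pos _).le, Real.exp_le_one_iff.2 (by linarith)⟩

/-- A measure on `[0, ∞)` is determined by its Laplace transform. -/
theorem IsLaplace.unique {σ τ : Measure ℝ} {g : ℝ → ℝ} (hσ : IsLaplace σ g)
    (hτ : IsLaplace τ g) : σ = τ := by
  have := hσ.isFiniteMeasure_expPush
  have := hτ.isFiniteMeasure_expPush
  have h : expPush σ = expPush τ := by
    refine ext_of_lintegral_pow hσ.ae_expPush hτ.ae_expPush fun m => ?_
    rw [lintegral_expPush, lintegral_expPush, (hσ.2 _ (by positivity)).2,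
      (hτ.2 _ (by positivity)).2]
  rw [← expPush_eq_self σ, h, expPush_eq_self]

/-! ### Bernstein's theorem -/

/-- `g` is completely monotonic on `(0, ∞)`, with `G n` as `(-1)^n` times its derivatives. -/
def IsCM (g : ℝ → ℝ) : Prop :=
  ∃ G : ℕ → ℝ → ℝ, (∀ x, 0 < x → G 0 x = g x) ∧
    ∀ n x, 0 < x → 0 ≤ G n x ∧ HasDerivAt (G n) (-G (n + 1) x) x

lemma IsCM.nonneg {g : ℝ → ℝ} (hg : IsCM g) {x : ℝ} (hx : 0 < x) : 0 ≤ g x := by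
  obtain ⟨G, h0, hG⟩ := hg
  exact h0 x hx ▸ (hG 0 x hx).1

lemma IsCM.continuousAt {g : ℝ → ℝ} (hg : IsCM g) {x : ℝ} (hx : 0 < x) : ContinuousAt g x := by
  obtain ⟨G, h0, hG⟩ := hg
  refine (hG 0 x hx).2.continuousAt.congr ?_
  filter_upwards [lt_mem_nhds hx] with y hy using h0 y hy

lemma IsCM.sub_shift {g : ℝ → ℝ} (hg : IsCM g) {h : ℝ} (hh : 0 < h) :
    IsCM fun x => g x - g (x + h) := by
  obtain ⟨G, h0, hG⟩ := hg
  refine ⟨fun n x => G n x - G n (x + h), fun x hx => ?_, fun n x hx => ⟨?_, ?_⟩⟩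
  · simp only [h0 x hx, h0 (x + h) (by linarith)]
  · have hanti : AntitoneOn (G n) (Ioi 0) := by
      refine antitoneOn_of_deriv_nonpos (convex_Ioi 0)
        (fun y hy => (hG n y hy).2.continuousAt.continuousWithinAt)
        (fun y hy => ?_) (fun y hy => ?_)
      · rw [interior_Ioi] at hy
        exact (hG n y hy).2.differentiableAt.differentiableWithinAt
      · rw [interior_Ioi] at hy
        rw [(hG n y hy).2.deriv]
        linarith [(hG (n + 1) y hy).1]
    exact sub_nonneg.2 (hanti (mem_Ioi.2 hx) (mem_Ioi.2 (by linarith)) (by linarith))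
  · have h2 := (hG n (x + h) (by linarith)).2.comp_add_const x h
    exact ((hG n x hx).2.sub h2).congr_deriv (by ring)

/-- Differencing the samples amounts to sampling $g(x)-g(x+h)$, which is again completely monotonic,
so the induction runs over all $g$ at once. Sampling starts at $h$ because $g$ may be unbounded near
$0$. -/
lemma IsCM.iterate_bdiff_nonneg {g : ℝ → ℝ} (hg : IsCM g) {h : ℝ} (hh : 0 < h) (m n : ℕ) :
    0 ≤ bdiff^[m] (fun i : ℕ => g (((i : ℝ) + 1) * h)) n := by
  induction m generalizing g with
  | zero => exact hg.nonneg (by positivity)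
  | succ m ih =>
    rw [Function.iterate_succ_apply]
    convert ih (hg.sub_shift hh) using 2
    ext i
    simp only [bdiff]
    congr 2
    push_cast
    ring

/-- `μ` is a finite measure on `[0, 1]` with moments `g ((m + 1) h)`. -/
def IsMomentMeasure (g : ℝ → ℝ) (h : ℝ) (μ : Measure ℝ) : Prop :=
  IsFiniteMeasure μ ∧ (∀ᵐ y ∂μ, y ∈ Icc (0 : ℝ) 1) ∧
    ∀ m : ℕ, ∫⁻ y, ENNReal.ofReal (y ^ m) ∂μ = ENNReal.ofReal (g (((m : ℝ) + 1) * h))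

lemma IsCM.exists_isMomentMeasure {g : ℝ → ℝ} (hg : IsCM g) {h : ℝ} (hh : 0 < h) :
    ∃ μ, IsMomentMeasure g h μ := by
  obtain ⟨μ, h1, h2, h3⟩ := exists_measure_moments (fun i : ℕ => g (((i : ℝ) + 1) * h))
    (hg.iterate_bdiff_nonneg hh)
  exact ⟨μ, h1, h2, fun m => by rw [lintegral_pow_eq h2, h3]⟩

/-- Both sides have the same moments, since $y^N(y^{N+1})^m=y^{(N+1)(m+1)-1}$. This consistency
under refinement of the step lets a single measure serve all rational arguments. -/
lemma IsMomentMeasure.eq_map {g : ℝ → ℝ} {h : ℝ} {μ ν : Measure ℝ}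
    (hμ : IsMomentMeasure g h μ) (N : ℕ) (hν : IsMomentMeasure g (h / (N + 1 : ℕ)) ν) :
    μ = (ν.withDensity fun y => ENNReal.ofReal (y ^ N)).map fun y => y ^ (N + 1) := by
  obtain ⟨hμ1, hμ2, hμ3⟩ := hμ
  obtain ⟨hν1, hν2, hν3⟩ := hν
  have hm : Measurable fun y : ℝ => y ^ (N + 1) := by fun_prop
  have hfin : IsFiniteMeasure (ν.withDensity fun y => ENNReal.ofReal (y ^ N)) :=
    isFiniteMeasure_withDensity (by rw [hν3]; exact ENNReal.ofReal_ne_top)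
  refine ext_of_lintegral_pow hμ2 ((ae_map_iff hm.aemeasurable measurableSet_Icc).2 ?_) fun m => ?_
  · refine (withDensity_absolutelyContinuous _ _).ae_le ?_
    filter_upwards [hν2] with y hy
    exact ⟨pow_nonneg hy.1 _, pow_le_one₀ hy.1 hy.2⟩
  · rw [hμ3, lintegral_map (by fun_prop) hm,
      lintegral_withDensity_eq_lintegral_mul _ (by fun_prop) (by fun_prop)]
    have h1 : ∫⁻ y, ((fun y => ENNReal.ofReal (y ^ N)) *
        fun y => ENNReal.ofReal ((y ^ (N + 1)) ^ m)) y ∂ν =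
        ∫⁻ y, ENNReal.ofReal (y ^ (N + (N + 1) * m)) ∂ν := by
      refine lintegral_congr_ae ?_
      filter_upwards [hν2] with y hy
      rw [Pi.mul_apply, ← ENNReal.ofReal_mul (pow_nonneg hy.1 _), ← pow_mul, ← pow_add]
    rw [h1, hν3]
    congr 2
    push_cast
    field_simp
    ring

lemma IsMomentMeasure.ae_pos {g : ℝ → ℝ} (hg : IsCM g) {h : ℝ} (hh : 0 < h) {μ : Measure ℝ}
    (hμ : IsMomentMeasure g h μ) : ∀ᵐ y ∂μ, y ∈ Ioc (0 : ℝ) 1 := by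
  -- With `N = 1` in `eq_map`, the density $y$ removes any mass at $0$.
  obtain ⟨ν, hν⟩ := hg.exists_isMomentMeasure (h := h / (1 + 1 : ℕ)) (by positivity)
  have h0 : ∀ᵐ y ∂μ, y ≠ 0 := by
    rw [hμ.eq_map 1 hν]
    refine (ae_map_iff (by fun_prop) (measurableSet_singleton (0 : ℝ)).compl).2 ?_
    refine (ae_withDensity_iff (by fun_prop)).2 (ae_of_all _ fun y hy => ?_)
    rintro h
    have : y = 0 := by simpa using h
    simp [this] at hy
  filter_upwards [h0, hμ.2.1] with y h1 h2 using ⟨lt_of_le_of_ne h2.1 (Ne.symm h1), h2.2⟩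

lemma lintegral_exp_antitone {σ : Measure ℝ} (hσ : σ (Iio 0) = 0) {x y : ℝ} (hxy : x ≤ y) :
    ∫⁻ s, ENNReal.ofReal (Real.exp (-(y * s))) ∂σ ≤
      ∫⁻ s, ENNReal.ofReal (Real.exp (-(x * s))) ∂σ := by
  refine lintegral_mono_ae ?_
  filter_upwards [ae_nonneg_of_null hσ] with s hs
  gcongr

/-- **Bernstein's theorem**. -/
theorem IsCM.exists_isLaplace {g : ℝ → ℝ} (hg : IsCM g) : ∃ σ, IsLaplace σ g := by
  obtain ⟨μ, hμ⟩ := hg.exists_isMomentMeasure one_pos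
  have hlog : Measurable fun y : ℝ => -Real.log y := by fun_prop
  let σ : Measure ℝ := (μ.withDensity fun y => ENNReal.ofReal y⁻¹).map fun y => -Real.log y
  have hσ : σ (Iio 0) = 0 := by
    rw [Measure.map_apply hlog measurableSet_Iio]
    refine withDensity_absolutelyContinuous _ _ ?_
    refine measure_mono_null (t := {y | ¬ y ∈ Ioc (0 : ℝ) 1}) (fun y hy => ?_)
      (ae_iff.1 (hμ.ae_pos hg one_pos))
    intro hy'
    have h1 : -Real.log y < 0 := hy
    linarith [Real.log_nonpos hy'.1.le hy'.2]
  -- With $q=(i+1)/(N+1)$, rewriting `μ` through the moment measure `ν` of step $1/(N+1)$ turns the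
  -- integral into the $i$-th moment of `ν`.
  have hrat : ∀ q : ℚ, 0 < q →
      ∫⁻ s, ENNReal.ofReal (Real.exp (-((q : ℝ) * s))) ∂σ = ENNReal.ofReal (g q) := by
    intro q hq
    obtain ⟨N, hN⟩ := Nat.exists_eq_succ_of_ne_zero q.den_ne_zero
    obtain ⟨j, hj⟩ := Int.eq_ofNat_of_zero_le (Rat.num_pos.2 hq).le
    obtain ⟨i, rfl⟩ := Nat.exists_eq_succ_of_ne_zero (n := j) (by
      rintro rfl
      have := Rat.num_pos.2 hq
      simp [hj] at this)
    have hqv : (q : ℝ) = ((i : ℝ) + 1) * (1 / ((N + 1 : ℕ) : ℝ)) := by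
      rw [Rat.cast_def, hj, hN]
      push_cast
      ring
    obtain ⟨ν, hν⟩ := hg.exists_isMomentMeasure (h := 1 / (N + 1 : ℕ)) (by positivity)
    have hm : Measurable fun y : ℝ => y ^ (N + 1) := by fun_prop
    rw [lintegral_map (by fun_prop) hlog,
      lintegral_withDensity_eq_lintegral_mul _ (by fun_prop) (by fun_prop), hμ.eq_map N hν,
      lintegral_map (by fun_prop) hm,
      lintegral_withDensity_eq_lintegral_mul _ (by fun_prop) (by fun_prop), hqv, ← hν.2.2 i]
    refine lintegral_congr_ae ?_
    filter_upwards [hν.ae_pos hg (by positivity)] with y hy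
    have hy0 : 0 < y := hy.1
    simp only [Pi.mul_apply]
    rw [← ENNReal.ofReal_mul (by positivity), ← ENNReal.ofReal_mul (by positivity)]
    congr 1
    have h1 : -(((i : ℝ) + 1) * (1 / ((N + 1 : ℕ) : ℝ)) * -Real.log (y ^ (N + 1))) =
        ((i + 1 : ℕ) : ℝ) * Real.log y := by
      rw [Real.log_pow]
      push_cast
      field_simp
    rw [h1, Real.exp_nat_mul, Real.exp_log hy0]
    field_simp
    ring
  refine ⟨σ, hσ, fun x hx => ⟨hg.nonneg hx, ?_⟩⟩
  -- From rational to real arguments: the integral is decreasing in $x$ and $g$ is continuous, so a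
  -- strict inequality either way is contradicted at a nearby rational on one side of $x$.
  have hcont : Tendsto (fun z => ENNReal.ofReal (g z)) (𝓝 x) (𝓝 (ENNReal.ofReal (g x))) :=
    (ENNReal.continuous_ofReal.tendsto _).comp (hg.continuousAt hx)
  refine le_antisymm (le_of_not_gt fun hlt => ?_) (le_of_not_gt fun hlt => ?_)
  · obtain ⟨l, hl, hl'⟩ := exists_Ioc_subset_of_mem_nhds (hcont.eventually_lt_const hlt) ⟨0, hx⟩
    obtain ⟨q, hq1, hq2⟩ := exists_rat_btwn (max_lt hl hx)
    have hq0 : 0 < q := by exact_mod_cast (le_max_right l 0).trans_lt hq1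
    have h1 := hl' ⟨(le_max_left l 0).trans_lt hq1, hq2.le⟩
    rw [mem_ofPred_eq, ← hrat q hq0] at h1
    exact absurd h1 (not_lt.2 (lintegral_exp_antitone hσ hq2.le))
  · obtain ⟨u, hu, hu'⟩ := exists_Ico_subset_of_mem_nhds (hcont.eventually_const_lt hlt)
      (exists_gt x)
    obtain ⟨q, hq1, hq2⟩ := exists_rat_btwn hu
    have hq0 : 0 < q := by exact_mod_cast hx.trans hq1
    have h1 := hu' ⟨hq1.le, hq2⟩
    rw [mem_ofPred_eq, ← hrat q hq0] at h1
    exact absurd h1 (not_lt.2 (lintegral_exp_antitone hσ hq1.le))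

/-! ### Measures in `A_0` and their distribution functions -/

lemma IsLaplace.integrable {σ : Measure ℝ} {g : ℝ → ℝ} (h : IsLaplace σ g) {x : ℝ} (hx : 0 < x) :
    Integrable (fun s => Real.exp (-(x * s))) σ := by
  refine ⟨by fun_prop, ?_⟩
  rw [hasFiniteIntegral_iff_ofReal (ae_of_all _ fun s => (Real.exp_pos _).le), (h.2 x hx).2]
  exact ENNReal.ofReal_lt_top

lemma IsLaplace.memA0 {σ : Measure ℝ} {g : ℝ → ℝ} (h : IsLaplace σ g) : MemA0 σ :=
  ⟨h.1, fun _ hx => h.integrable hx⟩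

lemma IsLaplace.integral_eq {σ : Measure ℝ} {g : ℝ → ℝ} (h : IsLaplace σ g) {x : ℝ} (hx : 0 < x) :
    ∫ s, Real.exp (-(x * s)) ∂σ = g x := by
  rw [integral_eq_lintegral_of_nonneg_ae (ae_of_all _ fun s => (Real.exp_pos _).le) (by fun_prop),
    (h.2 x hx).2, ENNReal.toReal_ofReal (h.2 x hx).1]

lemma IsLaplace.congr {σ : Measure ℝ} {g g' : ℝ → ℝ} (h : IsLaplace σ g)
    (hg : ∀ x, 0 < x → g x = g' x) : IsLaplace σ g' :=
  ⟨h.1, fun x hx => hg x hx ▸ h.2 x hx⟩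

lemma IsLaplace.add {σ τ : Measure ℝ} {g h : ℝ → ℝ} (hσ : IsLaplace σ g) (hτ : IsLaplace τ h) :
    IsLaplace (σ + τ) fun x => g x + h x := by
  refine ⟨by simp [hσ.1, hτ.1], fun x hx => ⟨add_nonneg (hσ.2 x hx).1 (hτ.2 x hx).1, ?_⟩⟩
  rw [lintegral_add_measure, (hσ.2 x hx).2, (hτ.2 x hx).2,
    ENNReal.ofReal_add (hσ.2 x hx).1 (hτ.2 x hx).1]

lemma IsLaplace.smul {σ : Measure ℝ} {g : ℝ → ℝ} (hσ : IsLaplace σ g) {c : ℝ} (hc : 0 ≤ c) :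
    IsLaplace (ENNReal.ofReal c • σ) fun x => c * g x := by
  refine ⟨by simp [hσ.1], fun x hx => ⟨mul_nonneg hc (hσ.2 x hx).1, ?_⟩⟩
  rw [lintegral_smul_measure, (hσ.2 x hx).2, ENNReal.ofReal_mul hc, smul_eq_mul]

lemma IsLaplace.sFinite {σ : Measure ℝ} {g : ℝ → ℝ} (h : IsLaplace σ g) : SFinite σ := by
  have := h.isFiniteMeasure_expPush
  rw [← expPush_eq_self σ]
  infer_instance

lemma MemA0.measure_Icc_lt_top {σ : Measure ℝ} (h : MemA0 σ) (t : ℝ) : σ (Icc 0 t) < ⊤ := by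
  have h1 := (h.2 1 one_pos).measure_ge_lt_top (Real.exp_pos (-t))
  refine (measure_mono fun s hs => ?_).trans_lt h1
  simp only [mem_ofPred_eq, one_mul]
  exact Real.exp_le_exp.2 (neg_le_neg hs.2)

lemma MemA0.ofReal_distFun {σ : Measure ℝ} (h : MemA0 σ) (t : ℝ) :
    ENNReal.ofReal (distFun σ t) = σ (Icc 0 t) :=
  ENNReal.ofReal_toReal (h.measure_Icc_lt_top t).ne

lemma distFun_nonneg (σ : Measure ℝ) (t : ℝ) : 0 ≤ distFun σ t := measureReal_nonneg

lemma MemA0.monotone_distFun {σ : Measure ℝ} (h : MemA0 σ) : Monotone (distFun σ) :=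
  fun _ b hab => measureReal_mono (Icc_subset_Icc_right hab) (h.measure_Icc_lt_top b).ne

lemma MemA0.tendsto_distFun {σ : Measure ℝ} (h : MemA0 σ) (t : ℝ) :
    Tendsto (distFun σ) (𝓝[>] t) (𝓝 (distFun σ t)) := by
  have h1 := tendsto_measure_biInter_gt (μ := σ) (s := fun r : ℝ => Icc 0 r) (a := t)
    (fun r _ => measurableSet_Icc.nullMeasurableSet) (fun i j _ hij => Icc_subset_Icc_right hij)
    ⟨t + 1, by linarith, (h.measure_Icc_lt_top _).ne⟩
  have h2 : (⋂ r > t, Icc (0 : ℝ) r) = Icc 0 t := by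
    ext s
    simp only [mem_iInter, mem_Icc]
    exact ⟨fun hs => ⟨(hs (t + 1) (by linarith)).1, le_of_forall_gt_imp_ge_of_dense
      fun r hr => (hs r hr).2⟩, fun hs r hr => ⟨hs.1, hs.2.trans (le_of_lt hr)⟩⟩
  rw [h2] at h1
  exact (ENNReal.tendsto_toReal (h.measure_Icc_lt_top t).ne).comp h1

lemma MemA0.continuousWithinAt_distFun {σ : Measure ℝ} (h : MemA0 σ) (t : ℝ) :
    ContinuousWithinAt (distFun σ) (Ici t) t :=
  continuousWithinAt_Ioi_iff_Ici.1 (h.tendsto_distFun t)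

lemma distFun_add {σ τ : Measure ℝ} (hσ : MemA0 σ) (hτ : MemA0 τ) (t : ℝ) :
    distFun (σ + τ) t = distFun σ t + distFun τ t := by
  rw [distFun, measureReal_add_apply (hσ.measure_Icc_lt_top t).ne (hτ.measure_Icc_lt_top t).ne]
  rfl

lemma distFun_smul (σ : Measure ℝ) {c : ℝ} (hc : 0 ≤ c) (t : ℝ) :
    distFun (ENNReal.ofReal c • σ) t = c * distFun σ t := by
  rw [distFun, measureReal_ennreal_smul_apply, ENNReal.toReal_ofReal hc]
  rfl

/-- The measure with density `G` on `[0, ∞)`. -/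
noncomputable def densityMeasure (G : ℝ → ℝ) : Measure ℝ :=
  (volume.restrict (Ici 0)).withDensity fun t => ENNReal.ofReal (G t)

lemma densityMeasure_Iio (G : ℝ → ℝ) : densityMeasure G (Iio 0) = 0 := by
  refine withDensity_absolutelyContinuous _ _ ?_
  rw [Measure.restrict_apply measurableSet_Iio]
  convert measure_empty (μ := volume)
  ext s
  simp

lemma densityMeasure_const_mul (G : ℝ → ℝ) (hG : Measurable G) {c : ℝ} (hc : 0 ≤ c) :
    densityMeasure (fun t => c * G t) = ENNReal.ofReal c • densityMeasure G := by
  rw [densityMeasure, densityMeasure, ← withDensity_smul _ (by fun_prop)]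
  congr 1
  ext t
  rw [ENNReal.ofReal_mul hc]
  rfl

lemma MemA0.densityMeasure_distFun {σ : Measure ℝ} (h : MemA0 σ) :
    densityMeasure (distFun σ) = volume.withDensity fun u => σ (Icc 0 u) := by
  simp_rw [densityMeasure, h.ofReal_distFun]
  rw [← withDensity_indicator measurableSet_Ici]
  congr 1
  ext u
  by_cases hu : u ∈ Ici (0 : ℝ)
  · rw [indicator_of_mem hu]
  · rw [indicator_of_notMem hu, Icc_eq_empty hu, measure_empty]

lemma MemA0.measurable_measure_Icc {σ : Measure ℝ} (h : MemA0 σ) :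
    Measurable fun u => σ (Icc 0 u) := by
  simp_rw [← h.ofReal_distFun]
  exact h.monotone_distFun.measurable.ennreal_ofReal

/-- Tonelli on $\{0\le s\le u\}$. It yields both the transform of a distribution function and the
integration by parts. -/
lemma lintegral_mul_measure_Icc {σ : Measure ℝ} [SFinite σ] (hσ : σ (Iio 0) = 0)
    {w : ℝ → ENNReal} (hw : Measurable w) :
    ∫⁻ u, w u * σ (Icc 0 u) = ∫⁻ s, ∫⁻ u in Ici s, w u ∂volume ∂σ := by
  have h1 : ∀ u, w u * σ (Icc 0 u) = ∫⁻ s, (Ici s).indicator w u ∂σ := by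
    intro u
    have h2 : ∀ᵐ s ∂σ, (Ici s).indicator w u = (Icc 0 u).indicator (fun _ => w u) s := by
      filter_upwards [ae_nonneg_of_null hσ] with s hs
      by_cases hsu : s ≤ u
      · rw [indicator_of_mem (mem_Ici.2 hsu), indicator_of_mem (mem_Icc.2 ⟨hs, hsu⟩)]
      · rw [indicator_of_notMem (s := Ici s) hsu,
          indicator_of_notMem (s := Icc 0 u) fun h => hsu h.2]
    rw [lintegral_congr_ae h2, lintegral_indicator measurableSet_Icc, setLIntegral_const]
  simp_rw [h1]
  rw [lintegral_lintegral_swap]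
  · refine lintegral_congr fun s => ?_
    rw [lintegral_indicator measurableSet_Ici]
  · have : (Function.uncurry fun u s : ℝ => (Ici s).indicator w u) =
        {p : ℝ × ℝ | p.2 ≤ p.1}.indicator fun p => w p.1 := by
      ext ⟨u, s⟩
      by_cases hsu : s ≤ u <;> simp [Function.uncurry, indicator, hsu]
    rw [this]
    exact ((hw.comp measurable_fst).indicator
      (measurableSet_le measurable_snd measurable_fst)).aemeasurable

lemma lintegral_exp_Ici {x : ℝ} (hx : 0 < x) (s : ℝ) :
    ∫⁻ u in Ici s, ENNReal.ofReal (Real.exp (-(x * u))) =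
      ENNReal.ofReal x⁻¹ * ENNReal.ofReal (Real.exp (-(x * s))) := by
  have hint : IntegrableOn (fun u => Real.exp (-(x * u))) (Ioi s) := by
    simpa using exp_neg_integrableOn_Ioi s hx
  rw [setLIntegral_congr Ioi_ae_eq_Ici.symm, ← ofReal_integral_eq_lintegral_ofReal hint
    (ae_of_all _ fun u => (Real.exp_pos _).le), ← ENNReal.ofReal_mul (by positivity)]
  congr 1
  have h := integral_exp_mul_Ioi (a := -x) (by linarith) s
  simp only [neg_mul] at h
  rw [h]
  field_simp

lemma IsLaplace.densityMeasure {σ : Measure ℝ} {g : ℝ → ℝ} (h : IsLaplace σ g) :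
    IsLaplace (densityMeasure (distFun σ)) fun x => x⁻¹ * g x := by
  have := h.sFinite
  refine ⟨densityMeasure_Iio _, fun x hx => ⟨mul_nonneg (by positivity) (h.2 x hx).1, ?_⟩⟩
  rw [h.memA0.densityMeasure_distFun, lintegral_withDensity_eq_lintegral_mul _
    h.memA0.measurable_measure_Icc (by fun_prop), ENNReal.ofReal_mul (by positivity),
    ← (h.2 x hx).2, ← lintegral_const_mul _ (by fun_prop)]
  simp_rw [← lintegral_exp_Ici hx]
  rw [← lintegral_mul_measure_Icc h.1 (by fun_prop)]
  refine lintegral_congr fun u => ?_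
  rw [Pi.mul_apply, mul_comm]

lemma IsLaplace.integral_distFun {σ : Measure ℝ} {g : ℝ → ℝ} (h : IsLaplace σ g) {x : ℝ}
    (hx : 0 < x) : IntegrableOn (fun t => Real.exp (-(x * t)) * distFun σ t) (Ioi 0) ∧
      x⁻¹ * g x = ∫ t in Ioi 0, Real.exp (-(x * t)) * distFun σ t := by
  have hm : Measurable (distFun σ) := h.memA0.monotone_distFun.measurable
  have h1 := (h.densityMeasure.2 x hx).2
  have h0 : 0 ≤ x⁻¹ * g x := (h.densityMeasure.2 x hx).1
  rw [LaplaceCM.densityMeasure, lintegral_withDensity_eq_lintegral_mul _ (by fun_prop)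
    (by fun_prop), setLIntegral_congr Ioi_ae_eq_Ici.symm] at h1
  have hnn : ∀ t, 0 ≤ Real.exp (-(x * t)) * distFun σ t := fun t =>
    mul_nonneg (Real.exp_pos _).le (distFun_nonneg _ _)
  have h2 : ∫⁻ t in Ioi 0, ENNReal.ofReal (Real.exp (-(x * t)) * distFun σ t) =
      ENNReal.ofReal (x⁻¹ * g x) := by
    rw [← h1]
    refine lintegral_congr fun t => ?_
    rw [Pi.mul_apply, mul_comm, ENNReal.ofReal_mul (distFun_nonneg _ _)]
  have hmeas : AEStronglyMeasurable (fun t => Real.exp (-(x * t)) * distFun σ t)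
      (volume.restrict (Ioi 0)) := by
    have : Measurable fun t => Real.exp (-(x * t)) * distFun σ t := by fun_prop
    exact this.aestronglyMeasurable
  refine ⟨⟨hmeas, ?_⟩, ?_⟩
  · rw [hasFiniteIntegral_iff_ofReal (ae_of_all _ hnn), h2]
    exact ENNReal.ofReal_lt_top
  · rw [integral_eq_lintegral_of_nonneg_ae (ae_of_all _ hnn) hmeas, h2,
      ENNReal.toReal_ofReal h0]

/-- The measure `t dσ(t)`. -/
noncomputable def mulId (σ : Measure ℝ) : Measure ℝ :=
  σ.withDensity fun t => ENNReal.ofReal t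

lemma IsLaplace.mulId {σ : Measure ℝ} {g g' : ℝ → ℝ} (h : IsLaplace σ g)
    (hg : ∀ x, 0 < x → HasDerivAt g (-g' x) x) : IsLaplace (mulId σ) g' := by
  refine ⟨withDensity_absolutelyContinuous _ _ h.1, fun x hx => ?_⟩
  -- The Laplace transform at $x$ is the moment generating function at $-x$, which is finite on all
  -- of $(-\infty,0)$ and so may be differentiated under the integral.
  have hmem : -x ∈ interior (ProbabilityTheory.integrableExpSet id σ) := by
    refine mem_interior.2 ⟨Iio 0, fun y hy => ?_, isOpen_Iio, by simpa using hx⟩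
    have := h.integrable (x := -y) (by simpa using hy)
    simpa [ProbabilityTheory.integrableExpSet] using this
  have hd := ProbabilityTheory.hasDerivAt_mgf hmem
  have hd2 : HasDerivAt (fun y => ProbabilityTheory.mgf id σ (-y))
      (-∫ s, id s * Real.exp (-x * id s) ∂σ) x := by
    have := hd.scomp x (hasDerivAt_neg x)
    simpa [Function.comp_def] using this
  have hd3 : HasDerivAt g (-∫ s, id s * Real.exp (-x * id s) ∂σ) x := by
    refine hd2.congr_of_eventuallyEq ?_
    filter_upwards [lt_mem_nhds hx] with y hy
    rw [← h.integral_eq hy, ProbabilityTheory.mgf]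
    simp
  have heq : g' x = ∫ s, s * Real.exp (-(x * s)) ∂σ := by
    have := (hg x hx).unique hd3
    simpa using this
  have hint : Integrable (fun s => s * Real.exp (-(x * s))) σ := by
    have := ProbabilityTheory.integrable_pow_mul_exp_of_mem_interior_integrableExpSet hmem 1
    simpa using this
  have hnn : ∀ᵐ s ∂σ, 0 ≤ s * Real.exp (-(x * s)) := by
    filter_upwards [ae_nonneg_of_null h.1] with s hs using mul_nonneg hs (Real.exp_pos _).le
  refine ⟨heq ▸ integral_nonneg_of_ae hnn, ?_⟩
  rw [heq, ofReal_integral_eq_lintegral_ofReal hint hnn, LaplaceCM.mulId,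
    lintegral_withDensity_eq_lintegral_mul _ (by fun_prop) (by fun_prop)]
  refine lintegral_congr_ae ?_
  filter_upwards [ae_nonneg_of_null h.1] with s hs
  rw [Pi.mul_apply, ENNReal.ofReal_mul hs]

/-- Integration by parts for `∫_{[0, t]} s dσ(s)`. -/
lemma distFun_mulId_add {σ : Measure ℝ} {g : ℝ → ℝ} (h : IsLaplace σ g)
    (h1 : MemA0 (mulId σ)) {t : ℝ} (ht : 0 ≤ t) :
    distFun (mulId σ) t + distFun (densityMeasure (distFun σ)) t = t * distFun σ t := by
  have := h.sFinite
  have hd := h.densityMeasure.memA0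
  rw [← distFun_add h1 hd, distFun, distFun, measureReal_def, measureReal_def,
    ← ENNReal.toReal_ofReal ht, ← ENNReal.toReal_mul, ENNReal.toReal_ofReal ht]
  congr 1
  -- $\int_0^t\sigma([0,u])\,du=\int_{[0,t]}(t-s)\,d\sigma(s)$; adding $\int_{[0,t]} s\,d\sigma(s)$
  -- leaves $t\,\sigma([0,t])$.
  have h2 : densityMeasure (distFun σ) (Icc 0 t) = ∫⁻ s in Icc 0 t, ENNReal.ofReal (t - s) ∂σ := by
    rw [h.memA0.densityMeasure_distFun, withDensity_apply _ measurableSet_Icc,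
      ← lintegral_indicator measurableSet_Icc]
    have h3 : ∀ u, (Icc 0 t).indicator (fun u => σ (Icc 0 u)) u =
        (Iic t).indicator 1 u * σ (Icc 0 u) := by
      intro u
      by_cases hu : u ≤ t
      · by_cases hu0 : 0 ≤ u
        · simp [hu, hu0]
        · simp [hu, hu0]
      · simp [hu]
    simp_rw [h3]
    rw [lintegral_mul_measure_Icc h.1 (measurable_one.indicator measurableSet_Iic),
      ← lintegral_indicator measurableSet_Icc]
    refine lintegral_congr_ae ?_
    filter_upwards [ae_nonneg_of_null h.1] with s hs
    rw [lintegral_indicator_one measurableSet_Iic, Measure.restrict_apply measurableSet_Iic,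
      Iic_inter_Ici, Real.volume_Icc]
    by_cases hst : s ≤ t
    · simp [hs, hst]
    · simp [hst, (not_le.1 hst).le]
  rw [Measure.add_apply, h2, mulId, withDensity_apply _ measurableSet_Icc,
    ← lintegral_add_left (by fun_prop)]
  rw [← setLIntegral_const]
  refine setLIntegral_congr_fun measurableSet_Icc fun s hs => ?_
  rw [← ENNReal.ofReal_add hs.1 (sub_nonneg.2 hs.2)]
  congr 1
  ring

lemma MemA0.distFun_densityMeasure {σ : Measure ℝ} (h : MemA0 σ) {t : ℝ} (ht : 0 ≤ t) :
    distFun (densityMeasure (distFun σ)) t = ∫ s in (0 : ℝ)..t, distFun σ s := by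
  have hi : IntervalIntegrable (distFun σ) volume 0 t := h.monotone_distFun.intervalIntegrable
  rw [intervalIntegral.integral_of_le ht, ← integral_Icc_eq_integral_Ioc,
    integral_eq_lintegral_of_nonneg_ae (ae_of_all _ fun s => distFun_nonneg _ _)
      h.monotone_distFun.measurable.aestronglyMeasurable, distFun, measureReal_def,
    densityMeasure, withDensity_apply _ measurableSet_Icc,
    Measure.restrict_restrict measurableSet_Icc, inter_eq_left.2 Icc_subset_Ici_self]

/-! ### Widder's functions -/

lemma hasDerivAt_iteratedDerivWithin_Ioi {u : ℝ → ℝ} (hu : ContDiffOn ℝ ∞ u (Ioi 0)) (n : ℕ)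
    {x : ℝ} (hx : 0 < x) : HasDerivAt (iteratedDerivWithin n u (Ioi 0))
      (iteratedDerivWithin (n + 1) u (Ioi 0) x) x := by
  have h1 := (hu.differentiableOn_iteratedDerivWithin (m := n)
    (by exact_mod_cast ENat.natCast_lt_top n) (uniqueDiffOn_Ioi 0)) x hx
  have h2 := h1.hasDerivWithinAt
  rw [← iteratedDerivWithin_succ] at h2
  exact h2.hasDerivAt (Ioi_mem_nhds hx)

lemma CompletelyMonotonic.isCM {g : ℝ → ℝ} (hg : CompletelyMonotonic g) : IsCM g := by
  refine ⟨fun n x => (-1 : ℝ) ^ n * iteratedDerivWithin n g (Ioi 0) x, fun x _ => by simp,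
    fun n x hx => ⟨hg.2 n x hx, ?_⟩⟩
  refine ((hasDerivAt_iteratedDerivWithin_Ioi hg.1 n hx).const_mul ((-1 : ℝ) ^ n)).congr_deriv ?_
  simp only [pow_succ]
  ring

lemma IsCM.add {g h : ℝ → ℝ} (hg : IsCM g) (hh : IsCM h) : IsCM fun x => g x + h x := by
  obtain ⟨G, hG0, hG⟩ := hg
  obtain ⟨H, hH0, hH⟩ := hh
  refine ⟨fun n x => G n x + H n x, fun x hx => by simp only [hG0 x hx, hH0 x hx],
    fun n x hx => ⟨add_nonneg (hG n x hx).1 (hH n x hx).1, ?_⟩⟩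
  exact ((hG n x hx).2.add (hH n x hx).2).congr_deriv (by ring)

lemma IsCM.const_mul {g : ℝ → ℝ} (hg : IsCM g) {c : ℝ} (hc : 0 ≤ c) : IsCM fun x => c * g x := by
  obtain ⟨G, hG0, hG⟩ := hg
  refine ⟨fun n x => c * G n x, fun x hx => by simp only [hG0 x hx],
    fun n x hx => ⟨mul_nonneg hc (hG n x hx).1, ?_⟩⟩
  exact ((hG n x hx).2.const_mul c).congr_deriv (by ring)

lemma IsCM.of_hasDerivAt {g g' : ℝ → ℝ} (hg' : IsCM g') (h0 : ∀ x, 0 < x → 0 ≤ g x)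
    (hd : ∀ x, 0 < x → HasDerivAt g (-g' x) x) : IsCM g := by
  obtain ⟨G, hG0, hG⟩ := hg'
  refine ⟨fun n => Nat.casesOn n g G, fun x _ => rfl, fun n x hx => ?_⟩
  cases n with
  | zero =>
    refine ⟨h0 x hx, (hd x hx).congr_deriv ?_⟩
    simp only [hG0 x hx]
  | succ n => exact hG n x hx

lemma iteratedDerivWithin_id_mul {u : ℝ → ℝ} (hu : ContDiffOn ℝ ∞ u (Ioi 0)) (n : ℕ) {x : ℝ}
    (hx : 0 < x) : iteratedDerivWithin (n + 1) (fun y => y * u y) (Ioi 0) x =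
      x * iteratedDerivWithin (n + 1) u (Ioi 0) x +
        ((n : ℝ) + 1) * iteratedDerivWithin n u (Ioi 0) x := by
  have hv : ContDiffOn ℝ ∞ (fun y => y * u y) (Ioi 0) := contDiffOn_id.mul hu
  induction n generalizing x with
  | zero =>
    have h1 := (hasDerivAt_id x).mul (hasDerivAt_iteratedDerivWithin_Ioi hu 0 hx)
    have h2 := hasDerivAt_iteratedDerivWithin_Ioi hv 0 hx
    simp only [iteratedDerivWithin_zero] at h1 h2
    rw [h2.unique h1]
    simp [iteratedDerivWithin_zero]
    ring
  | succ n ih =>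
    have h1 := ((hasDerivAt_id x).mul (hasDerivAt_iteratedDerivWithin_Ioi hu (n + 1) hx)).add
      ((hasDerivAt_iteratedDerivWithin_Ioi hu n hx).const_mul ((n : ℝ) + 1))
    have h2 := (hasDerivAt_iteratedDerivWithin_Ioi hv (n + 1) hx).congr_of_eventuallyEq
      (f₁ := fun y => y * iteratedDerivWithin (n + 1) u (Ioi 0) y +
        ((n : ℝ) + 1) * iteratedDerivWithin n u (Ioi 0) y) (by
        filter_upwards [lt_mem_nhds hx] with y hy using (ih hy).symm)
    rw [h2.unique h1]
    push_cast
    simp only [id]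
    ring

lemma widder_zero (f : ℝ → ℝ) : widder f 0 = f := by
  ext x
  simp [widder]

lemma hasDerivAt_widder {f : ℝ → ℝ} (hf : ContDiffOn ℝ ∞ f (Ioi 0)) (j : ℕ) {x : ℝ} (hx : 0 < x) :
    HasDerivAt (widder f j) (-((widder f (j + 1) x + ((j : ℝ) + 1) * widder f j x) / x)) x := by
  have hu : ContDiffOn ℝ ∞ (fun y => y ^ j * f y) (Ioi 0) := (contDiffOn_id.pow j).mul hf
  refine ((hasDerivAt_iteratedDerivWithin_Ioi hu j hx).const_mul ((-1 : ℝ) ^ j)).congr_deriv ?_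
  have h1 := iteratedDerivWithin_id_mul hu j hx
  have h2 : (fun y : ℝ => y * (y ^ j * f y)) = fun y => y ^ (j + 1) * f y := by
    ext y; ring
  rw [h2] at h1
  simp only [widder, h1]
  field_simp
  ring

lemma hasDerivAt_id_mul_widder {f : ℝ → ℝ} (hf : ContDiffOn ℝ ∞ f (Ioi 0)) (j : ℕ) {x : ℝ}
    (hx : 0 < x) : HasDerivAt (fun y => y * widder f j y)
      (-(widder f (j + 1) x + (j : ℝ) * widder f j x)) x := by
  refine ((hasDerivAt_id x).mul (hasDerivAt_widder hf j hx)).congr_deriv ?_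
  simp only [id]
  field_simp
  ring

/-! ### Monotone functions with prescribed right derivatives -/

lemma hasDerivWithinAt_integral_of_monotone {G : ℝ → ℝ} (hG : Monotone G) {t : ℝ}
    (ht : ContinuousWithinAt G (Ici t) t) (a : ℝ) :
    HasDerivWithinAt (fun u => ∫ s in a..u, G s) (G t) (Ici t) t :=
  intervalIntegral.integral_hasDerivWithinAt_right hG.intervalIntegrable (t := Ioi t)
    hG.measurable.stronglyMeasurable.stronglyMeasurableAtFilter (ht.mono Ioi_subset_Ici_self)

lemma continuous_integral_of_monotone {G : ℝ → ℝ} (hG : Monotone G) (a : ℝ) :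
    Continuous fun u => ∫ s in a..u, G s :=
  intervalIntegral.continuous_primitive (fun _ _ => hG.intervalIntegrable) a

/-- Here `K` need not be continuous, so $G/t^j=(K+(j+1)U)/t^{j+1}$ cannot simply be differentiated.
Freezing `K` at its value at the left end `a` gives a function with right derivative
$(K(t)-K(a))/t^{j+2}\ge0$ up to a positive constant; restoring `K b` at the right end only increases
it. -/
lemma monotoneOn_div_pow {G K : ℝ → ℝ} {j : ℕ} (hG : Monotone G)
    (hGr : ∀ t, 0 < t → ContinuousWithinAt G (Ici t) t) (hK : Monotone K)
    (h : ∀ t, 0 ≤ t → t * G t = K t + ((j : ℝ) + 1) * ∫ s in (0 : ℝ)..t, G s) :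
    MonotoneOn (fun t => G t / t ^ j) (Ioi 0) := by
  intro a ha b hb hab
  have ha : 0 < a := ha
  have hb : 0 < b := hb
  set U : ℝ → ℝ := fun u => ∫ s in (0 : ℝ)..u, G s with hU
  have hj : (0 : ℝ) < (j : ℝ) + 1 := by positivity
  have hkey := intervalIntegral.integral_le_sub_of_hasDeriv_right_of_le
    (g := fun t => (U t + K a / ((j : ℝ) + 1)) / t ^ (j + 1))
    (g' := fun t => (G t * t ^ (j + 1) - (U t + K a / ((j : ℝ) + 1)) *
      (((j + 1 : ℕ) : ℝ) * t ^ j)) / (t ^ (j + 1)) ^ 2) (φ := fun _ => 0) hab ?_ ?_ (by simp) ?_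
  · simp only [intervalIntegral.integral_zero] at hkey
    have hGK : ∀ t, 0 < t → G t / t ^ j = (K t + ((j : ℝ) + 1) * U t) / t ^ (j + 1) := by
      intro t ht
      rw [← h t ht.le, pow_succ]
      field_simp
    have hsplit : ∀ t, (K a + ((j : ℝ) + 1) * U t) / t ^ (j + 1) =
        ((j : ℝ) + 1) * ((U t + K a / ((j : ℝ) + 1)) / t ^ (j + 1)) := by
      intro t
      field_simp
      ring
    calc G a / a ^ j = (K a + ((j : ℝ) + 1) * U a) / a ^ (j + 1) := hGK a ha
      _ ≤ (K a + ((j : ℝ) + 1) * U b) / b ^ (j + 1) := by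
        rw [hsplit, hsplit]
        exact mul_le_mul_of_nonneg_left (sub_nonneg.1 hkey) hj.le
      _ ≤ (K b + ((j : ℝ) + 1) * U b) / b ^ (j + 1) := by
        gcongr
        exact hK hab
      _ = G b / b ^ j := (hGK b hb).symm
  · refine ContinuousOn.div ?_ (by fun_prop) fun t ht => ?_
    · exact ((continuous_integral_of_monotone hG 0).add continuous_const).continuousOn
    · have : 0 < t := ha.trans_le ht.1
      positivity
  · intro t ht
    have ht0 : 0 < t := ha.trans ht.1
    have h1 := ((hasDerivWithinAt_integral_of_monotone hG (hGr t ht0) 0).mono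
      Ioi_subset_Ici_self).add_const (K a / ((j : ℝ) + 1))
    have h2 := (hasDerivAt_pow (j + 1) t).hasDerivWithinAt (s := Ioi t)
    exact h1.div h2 (by positivity)
  · intro t ht
    have ht0 : 0 < t := ha.trans ht.1
    have h1 := h t ht0.le
    have h2 := hK ht.1.le
    have h3 : G t * t ^ (j + 1) - (U t + K a / ((j : ℝ) + 1)) * (((j + 1 : ℕ) : ℝ) * t ^ j) =
        t ^ j * (K t - K a) := by
      push_cast
      field_simp
      rw [pow_succ]
      linear_combination t ^ j * h1
    rw [h3]
    have := sub_nonneg.2 h2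
    positivity

/-- The infimum of `φ` is its right limit at $0$. Using it on all of $(-\infty,0]$ keeps `Q`
monotone on the whole line, hence interval integrable. -/
lemma exists_monotone_extension {φ : ℝ → ℝ} (hφ : MonotoneOn φ (Ioi 0))
    (h0 : ∀ t, 0 < t → 0 ≤ φ t) (hr : ∀ t, 0 < t → ContinuousWithinAt φ (Ici t) t) :
    ∃ Q : ℝ → ℝ, Monotone Q ∧ (∀ t, 0 < t → Q t = φ t) ∧
      ∀ t, 0 ≤ t → ContinuousWithinAt Q (Ici t) t := by
  have hbdd : BddBelow (φ '' Ioi 0) := ⟨0, by rintro _ ⟨t, ht, rfl⟩; exact h0 t ht⟩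
  have hlim := hφ.tendsto_nhdsGT hbdd
  set L := sInf (φ '' Ioi 0) with hL
  have hle : ∀ t, 0 < t → L ≤ φ t := fun t ht => csInf_le hbdd ⟨t, ht, rfl⟩
  refine ⟨fun t => if 0 < t then φ t else L, fun a b hab => ?_, fun t ht => if_pos ht,
    fun t ht => ?_⟩
  · by_cases ha : 0 < a
    · simp only [if_pos ha, if_pos (ha.trans_le hab)]
      exact hφ ha (ha.trans_le hab) hab
    · by_cases hb : 0 < b
      · simp only [if_neg ha, if_pos hb]
        exact hle b hb
      · simp only [if_neg ha, if_neg hb, le_refl]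
  · rcases ht.eq_or_lt with rfl | ht
    · rw [← continuousWithinAt_Ioi_iff_Ici, ContinuousWithinAt, if_neg (lt_irrefl _)]
      refine hlim.congr' ?_
      filter_upwards [self_mem_nhdsWithin] with s hs
      exact (if_pos hs).symm
    · refine (hr t ht).congr (fun s hs => if_pos (ht.trans_le hs)) (if_pos ht)

/-- If `t G(t) = ∫₀ᵗ G' + (j + 1) ∫₀ᵗ G`, then `G(t) / t ^ j` is a primitive of
`G'(t) / t ^ (j + 1)`. -/
lemma eq_add_integral_of_div_pow {G G' Q Q' : ℝ → ℝ} {j : ℕ} (hG : Monotone G)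
    (hG' : Monotone G') (hGr : ∀ t, 0 < t → ContinuousWithinAt G (Ici t) t)
    (hGr' : ∀ t, 0 < t → ContinuousWithinAt G' (Ici t) t)
    (h : ∀ t, 0 ≤ t → t * G t = (∫ s in (0 : ℝ)..t, G' s) + ((j : ℝ) + 1) * ∫ s in (0 : ℝ)..t, G s)
    (hQr : ContinuousWithinAt Q (Ici 0) 0) (hQ' : Monotone Q')
    (hQG : ∀ t, 0 < t → Q t = G t / t ^ j) (hQG' : ∀ t, 0 < t → Q' t = G' t / t ^ (j + 1)) :
    ContinuousOn Q (Ici 0) ∧ ∀ t, 0 ≤ t → Q t = Q 0 + ∫ s in (0 : ℝ)..t, Q' s := by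
  set N : ℝ → ℝ := fun t => (∫ s in (0 : ℝ)..t, G' s) + ((j : ℝ) + 1) * ∫ s in (0 : ℝ)..t, G s
    with hN
  have hNc : Continuous N := (continuous_integral_of_monotone hG' 0).add
    ((continuous_integral_of_monotone hG 0).const_mul _)
  -- This form shows that `Q` is continuous on $(0,\infty)$, although `G` is only assumed
  -- right-continuous there.
  have hQN : ∀ t, 0 < t → Q t = N t / t ^ (j + 1) := by
    intro t ht
    rw [hQG t ht, hN]
    simp only
    rw [← h t ht.le, pow_succ]
    field_simp
  have hcont : ContinuousOn Q (Ici 0) := by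
    intro t ht
    rcases (mem_Ici.1 ht).eq_or_lt with rfl | ht
    · exact hQr
    · have h1 : ContinuousAt (fun t => N t / t ^ (j + 1)) t :=
        hNc.continuousAt.div (by fun_prop) (by positivity)
      refine (h1.congr ?_).continuousWithinAt
      filter_upwards [lt_mem_nhds ht] with s hs using (hQN s hs).symm
  refine ⟨hcont, fun t ht => ?_⟩
  -- This form of the fundamental theorem needs right derivatives only inside the interval, so
  -- continuity of `Q` suffices at $0$.
  rw [intervalIntegral.integral_eq_sub_of_hasDeriv_right_of_le ht
    (hcont.mono Icc_subset_Ici_self) ?_ hQ'.intervalIntegrable]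
  · ring
  · intro s hs
    have hs0 : 0 < s := hs.1
    have h1 := (hasDerivWithinAt_integral_of_monotone hG' (hGr' s hs0) 0).add
      ((hasDerivWithinAt_integral_of_monotone hG (hGr s hs0) 0).const_mul ((j : ℝ) + 1))
    have h2 := (h1.mono Ioi_subset_Ici_self).div
      ((hasDerivAt_pow (j + 1) s).hasDerivWithinAt (s := Ioi s)) (by positivity)
    refine (h2.congr (fun y hy => hQN y (hs0.trans hy)) (hQN s hs0)).congr_deriv ?_
    have h3 := h s hs0.le
    simp only [Pi.add_apply, ← h3, hQG' s hs0]
    push_cast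
    field_simp
    ring

lemma hasDerivWithinAt_Ici_zero_of_eq_integral {Q Q' : ℝ → ℝ} (hQ' : Monotone Q')
    (hc : ContinuousOn Q' (Ici 0)) (h : ∀ t, 0 ≤ t → Q t = Q 0 + ∫ s in (0 : ℝ)..t, Q' s) {t : ℝ}
    (ht : 0 ≤ t) : HasDerivWithinAt Q (Q' t) (Ici 0) t := by
  have h1 : HasDerivWithinAt (fun u => ∫ s in (0 : ℝ)..u, Q' s) (Q' t) (Ici 0) t := by
    rcases ht.eq_or_lt with rfl | ht'
    · exact hasDerivWithinAt_integral_of_monotone hQ' (hc 0 self_mem_Ici) 0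
    · exact (intervalIntegral.integral_hasDerivAt_right hQ'.intervalIntegrable
        hQ'.measurable.stronglyMeasurable.stronglyMeasurableAtFilter
        (hc.continuousAt (Ici_mem_nhds ht'))).hasDerivWithinAt
  exact (h1.const_add (Q 0)).congr (fun s hs => h s hs) (h t ht)

lemma hasDerivWithinAt_Ici_of_eq_integral {Q Q' : ℝ → ℝ} (hQ' : Monotone Q') {t : ℝ}
    (ht : 0 ≤ t) (hc : ContinuousWithinAt Q' (Ici t) t)
    (h : ∀ t, 0 ≤ t → Q t = Q 0 + ∫ s in (0 : ℝ)..t, Q' s) :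
    HasDerivWithinAt Q (Q' t) (Ici t) t :=
  ((hasDerivWithinAt_integral_of_monotone hQ' hc 0).const_add (Q 0)).congr
    (fun s hs => h s (ht.trans hs)) (h t ht)

/-! ### Derivatives of `t ^ N * p(t)` -/

/-- The coefficient of `t ^ (N - i + l) * p^{(l)}` in the `i`-th derivative of `t ^ N * p(t)`. -/
def leibnizCoeff (N : ℕ) : ℕ → ℕ → ℕ
  | 0, l => if l = 0 then 1 else 0
  | i + 1, 0 => (N - i) * leibnizCoeff N i 0
  | i + 1, l + 1 => (N - i + (l + 1)) * leibnizCoeff N i (l + 1) + leibnizCoeff N i l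

lemma leibnizCoeff_eq_zero (N : ℕ) {i l : ℕ} (h : i < l) : leibnizCoeff N i l = 0 := by
  induction i generalizing l with
  | zero => simp [leibnizCoeff, h.ne']
  | succ i ih =>
    obtain ⟨l, rfl⟩ := Nat.exists_eq_succ_of_ne_zero (by omega : l ≠ 0)
    rw [leibnizCoeff, ih (by omega), ih (by omega)]
    simp

/-- The `i`-th derivative of `t ^ N * P 0 t`, when `P l` is the `l`-th derivative of `P 0`. -/
noncomputable def leibnizSum (N : ℕ) (P : ℕ → ℝ → ℝ) (i : ℕ) (t : ℝ) : ℝ :=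
  ∑ l ∈ Finset.range (i + 1), (leibnizCoeff N i l : ℝ) * (t ^ (N - i + l) * P l t)

lemma leibnizSum_zero (N : ℕ) (P : ℕ → ℝ → ℝ) (t : ℝ) : leibnizSum N P 0 t = t ^ N * P 0 t := by
  simp [leibnizSum, leibnizCoeff]

lemma leibnizSum_apply_zero {N i : ℕ} (hi : i < N) (P : ℕ → ℝ → ℝ) : leibnizSum N P i 0 = 0 :=
  Finset.sum_eq_zero fun l _ => by rw [zero_pow (by omega)]; simp

/-- The product rule on each term is the recursion for `leibnizCoeff`. The condition `i < N` keeps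
the truncated exponents correct. -/
lemma hasDerivWithinAt_leibnizSum {N i : ℕ} (hi : i < N) {P : ℕ → ℝ → ℝ} {s : Set ℝ} {t : ℝ}
    (h : ∀ l, l ≤ i → HasDerivWithinAt (P l) (P (l + 1) t) s t) :
    HasDerivWithinAt (leibnizSum N P i) (leibnizSum N P (i + 1) t) s t := by
  have h1 : HasDerivWithinAt (leibnizSum N P i) (∑ l ∈ Finset.range (i + 1),
      (leibnizCoeff N i l : ℝ) * ((((N - i + l : ℕ) : ℝ) * t ^ (N - i + l - 1)) * P l t +
        t ^ (N - i + l) * P (l + 1) t)) s t := by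
    refine HasDerivWithinAt.fun_sum fun l hl => ?_
    exact (((hasDerivAt_pow _ t).hasDerivWithinAt).mul
      (h l (Nat.lt_succ_iff.1 (Finset.mem_range.1 hl)))).const_mul _
  refine h1.congr_deriv ?_
  have h2 : ∑ l ∈ Finset.range (i + 1), (leibnizCoeff N i l : ℝ) *
      (((N - i + l : ℕ) : ℝ) * t ^ (N - i + l - 1) * P l t) =
      ∑ l ∈ Finset.range (i + 2), (leibnizCoeff N i l : ℝ) *
      (((N - i + l : ℕ) : ℝ) * t ^ (N - i + l - 1) * P l t) := by
    rw [Finset.sum_range_succ _ (i + 1), leibnizCoeff_eq_zero N (Nat.lt_succ_self i)]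
    simp
  simp_rw [mul_add, Finset.sum_add_distrib]
  rw [h2, leibnizSum, Finset.sum_range_succ' _ (i + 1), Finset.sum_range_succ' _ (i + 1),
    add_right_comm, ← Finset.sum_add_distrib]
  congr 1
  · refine Finset.sum_congr rfl fun l _ => ?_
    have e1 : N - (i + 1) + (l + 1) = N - i + l := by omega
    have e2 : N - i + (l + 1) - 1 = N - i + l := by omega
    rw [leibnizCoeff, e1, e2]
    push_cast
    ring
  · have e1 : N - (i + 1) + 0 = N - i + 0 - 1 := by omega
    rw [leibnizCoeff, e1]
    push_cast
    ring

lemma MemA0.add {σ τ : Measure ℝ} (hσ : MemA0 σ) (hτ : MemA0 τ) : MemA0 (σ + τ) :=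
  ⟨by simp [hσ.1, hτ.1], fun x hx => (hσ.2 x hx).add_measure (hτ.2 x hx)⟩

lemma MemA0.smul {σ : Measure ℝ} (hσ : MemA0 σ) (c : ℝ) : MemA0 (ENNReal.ofReal c • σ) :=
  ⟨by simp [hσ.1], fun x hx => (hσ.2 x hx).smul_measure ENNReal.ofReal_ne_top⟩

lemma memA0_sum_and_distFun_sum {σ : ℕ → Measure ℝ} {c : ℕ → ℝ} (hc : ∀ l, 0 ≤ c l) (n : ℕ)
    (hσ : ∀ l, l < n → MemA0 (σ l)) :
    MemA0 (∑ l ∈ Finset.range n, ENNReal.ofReal (c l) • σ l) ∧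
      ∀ t, distFun (∑ l ∈ Finset.range n, ENNReal.ofReal (c l) • σ l) t =
        ∑ l ∈ Finset.range n, c l * distFun (σ l) t := by
  induction n with
  | zero => exact ⟨⟨by simp, fun x _ => by simp⟩, fun t => by simp [distFun]⟩
  | succ n ih =>
    obtain ⟨h1, h2⟩ := ih fun l hl => hσ l (by omega)
    have h3 := (hσ n (by omega)).smul (c n)
    rw [Finset.sum_range_succ]
    refine ⟨h1.add h3, fun t => ?_⟩
    rw [distFun_add h1 h3, h2, distFun_smul _ (hc n), Finset.sum_range_succ]

lemma memA_of_isDerivSeq {m : ℕ} {P : ℕ → ℝ → ℝ} {σ : ℕ → Measure ℝ}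
    (hσ : ∀ j, j ≤ m + 1 → MemA0 (σ j))
    (hP : ∀ j, j ≤ m + 1 → ∀ t, 0 ≤ t → t ^ j * P j t = distFun (σ j) t)
    (hd : IsDerivSeq (m + 2) (P 0) P) :
    ∃ τ, MemA (m + 2) τ fun t => t ^ (m + 1) * P 0 t := by
  -- At order $N=m+1$ the powers left in the Leibniz sum are exactly $t^l$, so each term is a
  -- multiple of the distribution function of `σ l`.
  obtain ⟨hτ, hτd⟩ := memA0_sum_and_distFun_sum (σ := σ)
    (c := fun l => (leibnizCoeff (m + 1) (m + 1) l : ℝ)) (fun l => Nat.cast_nonneg _) (m + 2)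
    fun l hl => hσ l (by omega)
  set τ := ∑ l ∈ Finset.range (m + 2),
    ENNReal.ofReal (leibnizCoeff (m + 1) (m + 1) l : ℝ) • σ l
  obtain ⟨-, hd1, hd2⟩ := hd
  have hlast : ∀ t, 0 ≤ t → leibnizSum (m + 1) P (m + 1) t = distFun τ t := by
    intro t ht
    rw [hτd, leibnizSum]
    refine Finset.sum_congr rfl fun l hl => ?_
    rw [Nat.sub_self, zero_add, hP l (by have := Finset.mem_range.1 hl; omega) t ht]
  refine ⟨τ, hτ, leibnizSum (m + 1) P, fun t _ => leibnizSum_zero _ _ _, fun j hj t ht => ?_,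
    fun j hj => leibnizSum_apply_zero (by omega) P, fun t ht => ?_⟩
  · exact hasDerivWithinAt_leibnizSum (by omega) fun l hl => hd1 l (by omega) t ht
  · have hcont : ContinuousOn (leibnizSum (m + 1) P m) (Ici 0) := by
      refine continuousOn_finsetSum _ fun l hl => ?_
      refine continuousOn_const.mul (ContinuousOn.mul (by fun_prop) ?_)
      have hl : l < m + 1 := Finset.mem_range.1 hl
      rcases Nat.lt_succ_iff_lt_or_eq.1 hl with hlm | rfl
      · exact fun s hs => (hd1 l (by omega) s hs).continuousWithinAt
      · exact (hd2 l rfl).1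
    rw [← intervalIntegral.integral_congr (f := leibnizSum (m + 1) P (m + 1)) fun s hs =>
      hlast s (by rw [uIcc_of_le ht] at hs; exact hs.1),
      intervalIntegral.integral_eq_sub_of_hasDeriv_right_of_le ht
        (hcont.mono Icc_subset_Ici_self) ?_ ?_, leibnizSum_apply_zero (Nat.lt_succ_self m), sub_zero]
    · intro s hs
      refine (hasDerivWithinAt_leibnizSum (Nat.lt_succ_self m) fun l hl => ?_).mono
        Ioi_subset_Ici_self
      rcases hl.lt_or_eq with hlm | rfl
      · exact (hd1 l (by omega) s hs.1.le).mono (Ici_subset_Ici.2 hs.1.le)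
      · exact (hd2 l rfl).2 s hs.1.le
    · refine (hτ.monotone_distFun.intervalIntegrable (a := 0) (b := t)).congr ?_
      intro s hs
      rw [uIoc_of_le ht] at hs
      exact (hlast s hs.1.le).symm

/-! ### The representation theorem -/

lemma isCM_id_mul_widder {f : ℝ → ℝ} {j : ℕ} (hf : ContDiffOn ℝ ∞ f (Ioi 0))
    (h : IsCM (widder f j)) (h' : IsCM (widder f (j + 1))) : IsCM fun x => x * widder f j x :=
  (h'.add (h.const_mul (Nat.cast_nonneg j))).of_hasDerivAt
    (fun _ hx => mul_nonneg hx.le (h.nonneg hx)) fun _ hx => hasDerivAt_id_mul_widder hf j hx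

/-- Both sides have Laplace transform $-(x\,w_j)'=w_{j+1}+j\,w_j$. -/
lemma mulId_eq_add {f : ℝ → ℝ} (hf : ContDiffOn ℝ ∞ f (Ioi 0)) {j : ℕ} {σ κ : Measure ℝ}
    (hσ : IsLaplace σ fun x => x * widder f j x) (hκ : IsLaplace κ (widder f (j + 1))) :
    mulId σ = κ + ENNReal.ofReal j • densityMeasure (distFun σ) := by
  have h1 := hσ.mulId fun x hx => hasDerivAt_id_mul_widder hf j hx
  refine h1.unique ((hκ.add (hσ.densityMeasure.smul (Nat.cast_nonneg j))).congr fun x hx => ?_)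
  field_simp

lemma mul_distFun_eq {f : ℝ → ℝ} (hf : ContDiffOn ℝ ∞ f (Ioi 0)) {j : ℕ} {σ κ : Measure ℝ}
    (hσ : IsLaplace σ fun x => x * widder f j x) (hκ : IsLaplace κ (widder f (j + 1))) {t : ℝ}
    (ht : 0 ≤ t) :
    t * distFun σ t = distFun κ t + ((j : ℝ) + 1) * ∫ s in (0 : ℝ)..t, distFun σ s := by
  have h1 := (hσ.mulId fun x hx => hasDerivAt_id_mul_widder hf j hx).memA0
  have hd := hσ.densityMeasure.memA0
  rw [← distFun_mulId_add hσ h1 ht, mulId_eq_add hf hσ hκ, distFun_add hκ.memA0 (hd.smul _),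
    distFun_smul _ (Nat.cast_nonneg j), hσ.memA0.distFun_densityMeasure ht]
  ring

lemma exists_monotone_mul_pow_eq_distFun {f : ℝ → ℝ} (hf : ContDiffOn ℝ ∞ f (Ioi 0)) {j : ℕ}
    {σ κ : Measure ℝ} (hσ : IsLaplace σ fun x => x * widder f j x)
    (hκ : IsLaplace κ (widder f (j + 1))) :
    ∃ Q : ℝ → ℝ, Monotone Q ∧ (∀ t, 0 ≤ t → ContinuousWithinAt Q (Ici t) t) ∧
      ∀ t, 0 ≤ t → t ^ j * Q t = distFun σ t := by
  have hG := hσ.memA0.continuousWithinAt_distFun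
  obtain ⟨Q, hQm, hQ, hQr⟩ := exists_monotone_extension
    (monotoneOn_div_pow hσ.memA0.monotone_distFun (fun t _ => hG t) hκ.memA0.monotone_distFun
      fun t ht => mul_distFun_eq hf hσ hκ ht)
    (fun t ht => div_nonneg (distFun_nonneg _ _) (by positivity))
    (fun t ht => (hG t).div (by fun_prop) (by positivity))
  refine ⟨Q, hQm, hQr, ?_⟩
  have hpos : ∀ t, 0 < t → t ^ j * Q t = distFun σ t := fun t ht => by
    rw [hQ t ht]
    field_simp
  intro t ht
  rcases ht.eq_or_lt with rfl | ht
  -- At $t=0$ the identity follows from right continuity of both sides.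
  · have h1 : Tendsto (fun t => t ^ j * Q t) (𝓝[>] 0) (𝓝 ((0 : ℝ) ^ j * Q 0)) :=
      ((continuous_pow j).continuousWithinAt.mul (hQr 0 le_rfl)).mono Ioi_subset_Ici_self
    refine tendsto_nhds_unique (h1.congr' ?_) (hσ.memA0.tendsto_distFun 0)
    filter_upwards [self_mem_nhdsWithin] with s hs using hpos s hs
  · exact hpos t ht

end LaplaceCM

theorem theorem2 (f : ℝ → ℝ) (k : ℕ) (hk : 1 ≤ k)
    (hf : ∀ j : ℕ, j ≤ k → LaplaceCM.CompletelyMonotonic (LaplaceCM.widder f j)) :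
    ∃ (p : ℝ → ℝ) (P : ℕ → ℝ → ℝ) (τ : Measure ℝ) (σ : ℕ → Measure ℝ),
      (∀ x : ℝ, 0 < x →
        IntegrableOn (fun t => Real.exp (-(x * t)) * p t) (Ioi 0) ∧
        f x = ∫ t in Ioi (0 : ℝ), Real.exp (-(x * t)) * p t) ∧
      LaplaceCM.MemA k τ (fun t => t ^ (k - 1) * p t) ∧
      LaplaceCM.IsDerivSeq k p P ∧
      (∀ j : ℕ, j ≤ k - 1 → LaplaceCM.MemA 1 (σ j) (fun t => t ^ j * P j t)) ∧
      LaplaceCM.IsDiffMeasure ((k : ℝ) - 1) (σ (k - 1)) (σ k) ∧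
      LaplaceCM.MemA0 (σ k) ∧
      (∀ j : ℕ, j ≤ k - 1 → ∀ x : ℝ, 0 < x →
        IntegrableOn (fun t => Real.exp (-(x * t)) * (t ^ j * P j t)) (Ioi 0) ∧
        LaplaceCM.widder f j x = ∫ t in Ioi (0 : ℝ), Real.exp (-(x * t)) * (t ^ j * P j t)) ∧
      (∀ x : ℝ, 0 < x →
        LaplaceCM.widder f k x = ∫ t, Real.exp (-(x * t)) ∂(σ k)) := by
  open LaplaceCM in
  obtain ⟨n, rfl⟩ := Nat.exists_eq_add_of_le' hk
  simp only [Nat.add_sub_cancel]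
  have hfs : ContDiffOn ℝ ∞ f (Ioi 0) := by
    have := (hf 0 (by omega)).1
    rwa [widder_zero] at this
  -- The last measure plays a different role: `σ j` represents $x\,w_j$ for $j\le n$, but `σ (n +
  -- 1)` represents $w_{n+1}$ without the factor $x$.
  have hσ : ∀ j, ∃ σ : Measure ℝ, (j ≤ n → IsLaplace σ fun x => x * widder f j x) ∧
      (j = n + 1 → IsLaplace σ (widder f (n + 1))) := by
    intro j
    by_cases hj : j ≤ n
    · obtain ⟨σ, h⟩ := (isCM_id_mul_widder hfs (hf j (by omega)).isCM
        (hf (j + 1) (by omega)).isCM).exists_isLaplace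
      exact ⟨σ, fun _ => h, fun h' => by omega⟩
    · obtain ⟨σ, h⟩ := (hf (n + 1) le_rfl).isCM.exists_isLaplace
      exact ⟨σ, fun h' => absurd h' hj, fun _ => h⟩
  choose σ hσ hσ' using hσ
  have hσn := hσ' (n + 1) rfl
  have hdens : ∀ j, j < n → IsLaplace (densityMeasure (distFun (σ (j + 1)))) (widder f (j + 1)) :=
    fun j hj => (hσ (j + 1) (by omega)).densityMeasure.congr fun x hx => by field_simp
  have hκ : ∀ j, j ≤ n → ∃ κ, IsLaplace κ (widder f (j + 1)) := by
    intro j hj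
    rcases hj.lt_or_eq with h | rfl
    · exact ⟨_, hdens j h⟩
    · exact ⟨_, hσn⟩
  have hP : ∀ j, ∃ Q : ℝ → ℝ, j ≤ n → Monotone Q ∧
      (∀ t, 0 ≤ t → ContinuousWithinAt Q (Ici t) t) ∧
      ∀ t, 0 ≤ t → t ^ j * Q t = distFun (σ j) t := by
    intro j
    by_cases hj : j ≤ n
    · obtain ⟨κ, h⟩ := hκ j hj
      obtain ⟨Q, hQ⟩ := exists_monotone_mul_pow_eq_distFun hfs (hσ j hj) h
      exact ⟨Q, fun _ => hQ⟩
    · exact ⟨0, fun h => absurd h hj⟩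
  choose P hP using hP
  have hPdiv : ∀ j, j ≤ n → ∀ t, 0 < t → P j t = distFun (σ j) t / t ^ j := by
    intro j hj t ht
    rw [← (hP j hj).2.2 t ht.le]
    field_simp
  have hprim : ∀ j, j < n → ContinuousOn (P j) (Ici 0) ∧
      ∀ t, 0 ≤ t → P j t = P j 0 + ∫ s in (0 : ℝ)..t, P (j + 1) s := by
    intro j hj
    have h0 := (hσ j hj.le).memA0
    have h1 := (hσ (j + 1) hj).memA0
    refine eq_add_integral_of_div_pow h0.monotone_distFun h1.monotone_distFun
      (fun t _ => h0.continuousWithinAt_distFun t) (fun t _ => h1.continuousWithinAt_distFun t)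
      (fun t ht => ?_) ((hP j hj.le).2.1 0 le_rfl) (hP (j + 1) hj).1 (hPdiv j hj.le)
      (hPdiv (j + 1) hj)
    rw [mul_distFun_eq hfs (hσ j hj.le) (hdens j hj) ht, h1.distFun_densityMeasure ht]
  have hderiv : IsDerivSeq (n + 1) (P 0) P := by
    -- Below the top order `P (j + 1)` is itself a primitive, hence continuous, and the derivative
    -- is an ordinary one. At the top order only right continuity of `P n` is available.
    refine ⟨fun _ _ => rfl, fun j hj t ht => ?_, fun j hj => ?_⟩
    · exact hasDerivWithinAt_Ici_zero_of_eq_integral (hP (j + 1) (by omega)).1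
        (hprim (j + 1) (by omega)).1 (hprim j (by omega)).2 ht
    · exact ⟨(hprim j (by omega)).1, fun t ht => hasDerivWithinAt_Ici_of_eq_integral
        (hP (j + 1) (by omega)).1 ht ((hP (j + 1) (by omega)).2.1 t ht) (hprim j (by omega)).2⟩
  have hint : ∀ j : ℕ, j ≤ n → ∀ x : ℝ, 0 < x →
      IntegrableOn (fun t => Real.exp (-(x * t)) * (t ^ j * P j t)) (Ioi 0) ∧
      widder f j x = ∫ t in Ioi (0 : ℝ), Real.exp (-(x * t)) * (t ^ j * P j t) := by
    intro j hj x hx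
    obtain ⟨h1, h2⟩ := (hσ j hj).integral_distFun hx
    have hc : EqOn (fun t => Real.exp (-(x * t)) * distFun (σ j) t)
        (fun t => Real.exp (-(x * t)) * (t ^ j * P j t)) (Ioi 0) := fun t ht => by
      simp only [(hP j hj).2.2 t (le_of_lt ht)]
    refine ⟨h1.congr_fun hc measurableSet_Ioi, ?_⟩
    rw [← setIntegral_congr_fun measurableSet_Ioi hc, ← h2]
    field_simp
  have hτ : ∃ τ, MemA (n + 1) τ fun t => t ^ n * P 0 t := by
    cases n with
    | zero =>
      exact ⟨σ 0, (hσ 0 le_rfl).memA0, fun t ht => (hP 0 le_rfl).2.2 t ht⟩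
    | succ m =>
      exact memA_of_isDerivSeq (fun j hj => (hσ j hj).memA0) (fun j hj => (hP j hj).2.2) hderiv
  obtain ⟨τ, hτ⟩ := hτ
  refine ⟨P 0, P, τ, σ, fun x hx => ?_, hτ, hderiv, fun j hj => ⟨(hσ j hj).memA0, (hP j hj).2.2⟩,
    ?_, hσn.memA0, hint, fun x hx => (hσn.integral_eq hx).symm⟩
  · have := hint 0 (Nat.zero_le n) x hx
    rw [widder_zero] at this
    simpa only [pow_zero, one_mul] using this
  · have h := mulId_eq_add hfs (hσ n le_rfl) hσn
    rw [← densityMeasure_const_mul _ (hσ n le_rfl).memA0.monotone_distFun.measurable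
      (Nat.cast_nonneg n)] at h
    simp only [Nat.cast_add, Nat.cast_one, add_sub_cancel_right]
    exact h.symm
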